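/- There is an absolute constant $C>0$ such that the following holds. Let $G=(V,E)$ be a finite simple graph with $n$ vertices and treewidth $t\ge 1$, and let $\lambda>0$. Let $\mu$ be the Gibbs distribution of the hardcore model on $G$ with fugacity $\lambda$, that is, the probability distribution on the independent sets $I$ of $G$ with $\mu(I)=\lambda^{|I|}/\sum_{J}\lambda^{|J|}$, where $J$ ranges over all independent sets of $G$. The Glauber dynamics for $\mu$ is the Markov chain on independent sets which in each step chooses a vertex $v\in V$ uniformly at random and resamples whether $v$ is occupied from its conditional distribution under $\mu$ given the status of all other vertices. Its mixing time, that is, the smallest integer $T\ge 0$ such that from every initial independent set the distribution after $T$ steps is within total variation distance $1/4$ of $\mu$, is finite and at most \[ n^{\,C\,(1+t\log(1+\lambda))}. \] -/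

import Mathlib

/-- A tree decomposition of a graph `G`: a finite tree (with node set `Fin m`), each of whose nodes
carries a bag of vertices of `G`, such that every vertex and every edge of `G` is contained in some
bag and, for every vertex `v`, the nodes whose bags contain `v` induce a connected subtree. -/
structure TreeDecomposition {V : Type*} (G : SimpleGraph V) where
  m : ℕ
  tree : SimpleGraph (Fin m)
  isTree : tree.IsTree
  bag : Fin m → Finset V
  vertex_mem : ∀ v, ∃ i, v ∈ bag i
  edge_mem : ∀ u v, G.Adj u v → ∃ i, u ∈ bag i ∧ v ∈ bag i
  connected : ∀ v, (tree.induce {i | v ∈ bag i}).Connected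

/-- The width of a tree decomposition: the largest size of a bag, minus one. (If all bags are
empty, which happens only for the graph without vertices, this is `0`.) -/
def TreeDecomposition.width {V : Type*} {G : SimpleGraph V} (D : TreeDecomposition G) : ℕ :=
  (Finset.univ.sup fun i => (D.bag i).card) - 1

/-- The treewidth of a finite graph: the minimum width of a tree decomposition. -/
noncomputable def treewidth {V : Type*} [Finite V] (G : SimpleGraph V) : ℕ :=
  sInf (Set.range fun D : TreeDecomposition G => D.width)

section Hardcore

variable {V : Type*} [Fintype V] [DecidableEq V]

/-- The weight of a configuration `σ` (`true` = occupied) in the hardcore model with fugacity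
`lam`: `lam ^ |I|` if the set `I` of occupied vertices is independent, and `0` otherwise. -/
noncomputable def hardcoreWeight (G : SimpleGraph V) (lam : ℝ) (σ : V → Bool) : ℝ :=
  open Classical in
  if G.IsIndepSet {v | σ v = true} then lam ^ (Finset.univ.filter fun v => σ v = true).card else 0

/-- The Gibbs distribution of the hardcore model, as a probability mass function on
configurations. -/
noncomputable def hardcoreGibbs (G : SimpleGraph V) (lam : ℝ) (σ : V → Bool) : ℝ :=
  hardcoreWeight G lam σ / ∑ τ : V → Bool, hardcoreWeight G lam τ

end Hardcore

section Glauber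

variable {V Q : Type*} [Fintype V] [DecidableEq V] [Fintype Q] [DecidableEq Q]

/-- The conditional probability, under `μ`, that vertex `v` has spin `q` given that all the other
vertices have the spins prescribed by `σ`. -/
noncomputable def siteConditional (μ : (V → Q) → ℝ) (v : V) (σ : V → Q) (q : Q) : ℝ :=
  μ (Function.update σ v q) / ∑ q' : Q, μ (Function.update σ v q')

/-- The transition matrix of the Glauber dynamics for `μ`: a vertex `v` is chosen uniformly at
random and its spin is resampled from the conditional distribution given all other spins.
Only the rows of feasible configurations (`0 < μ σ`) are meaningful; from such a configuration the
chain only reaches feasible configurations. -/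
noncomputable def glauberMatrix (μ : (V → Q) → ℝ) : Matrix (V → Q) (V → Q) ℝ :=
  Matrix.of fun σ τ => ∑ v : V, (1 / (Fintype.card V : ℝ)) *
    (if ∀ w, w ≠ v → τ w = σ w then siteConditional μ v σ (τ v) else 0)

end Glauber

/-- The total variation distance of two probability mass functions on a finite set. -/
noncomputable def tvDist {X : Type*} [Fintype X] (p q : X → ℝ) : ℝ :=
  (1 / 2) * ∑ x, |p x - q x|

/-- `T` is the mixing time of the Glauber dynamics for `μ`: the smallest `T` such that, from any
feasible initial configuration, the distribution after `T` steps is within total variation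
distance `1/4` of `μ`. In particular, such a `T` exists. -/
def IsGlauberMixingTime {V Q : Type*} [Fintype V] [DecidableEq V] [Fintype Q] [DecidableEq Q]
    (μ : (V → Q) → ℝ) (T : ℕ) : Prop :=
  IsLeast {s : ℕ | ∀ σ : V → Q, 0 < μ σ → tvDist ((glauberMatrix μ ^ s) σ) μ ≤ 1 / 4} T

/-! Bounded treewidth forces small treedepth, and small treedepth forces a good Poincaré constant.
Every vertex set of a graph with a tree decomposition is split by some bag into mutually
non-adjacent parts of at most half its size (`exists_balanced`). Recursing, the whole graph is built
from the empty set by disjoint unions and at most d = (⌊log₂ n⌋ + 1)(t + 1) nested insertions of a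
vertex (`treeDepthLE_of_card_bag_le`).

Disjoint unions without edges in between keep the Poincaré constant (`Poincare.union`), since the
measure is a product. Inserting a vertex v multiplies it by at most 1 + 2λ (`Poincare.insert`):
conditioned on v, the measure is a hardcore model on the remaining vertices, or on the
non-neighbours of v, and the difference of the two conditional means is controlled by the flips of v
and the variance with v vacant. Hence the constant is at most 2(1 + 2λ)^d ≤ 2(1 + λ)^(2d), which is
n^(O(t log(1 + λ))) up to the factor 2.

A Poincaré inequality makes the variance decay geometrically (`PoincareGlauber.variance_pow`), and
total variation is bounded by that decay divided by the mass of the starting state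
(`PoincareGlauber.tvDist_sq_le`). For λ ≥ 1/(16n) this mass is not too small. For λ ≤ 1/(16n) it can
be arbitrarily small, but then both the chain after 16n² steps and the Gibbs distribution sit mostly
on the empty set (`tvDist_le_of_small_fugacity`). -/

/-! ### Poincaré inequalities for the hardcore model: vertex insertion and disjoint union. -/

section Poincare

variable {V : Type*} [DecidableEq V] (G : SimpleGraph V) (lam : ℝ)

/-- The hardcore weight of a finite vertex set. -/
noncomputable def indepWeight (I : Finset V) : ℝ :=
  open Classical in if G.IsIndepSet (I : Set V) then lam ^ I.card else 0

/-- The hardcore partition function of the graph induced on `A`. -/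
noncomputable def partitionFn (A : Finset V) : ℝ := ∑ I ∈ A.powerset, indepWeight G lam I

/-- The variance of `f` under the hardcore model on `A`, times the squared partition function. -/
noncomputable def varForm (A : Finset V) (f : Finset V → ℝ) : ℝ :=
  partitionFn G lam A * ∑ I ∈ A.powerset, indepWeight G lam I * f I ^ 2
    - (∑ I ∈ A.powerset, indepWeight G lam I * f I) ^ 2

/-- The unnormalized Dirichlet form of the hardcore model on `A`. -/
noncomputable def dirichletForm (A : Finset V) (f : Finset V → ℝ) : ℝ :=
  ∑ v ∈ A, ∑ I ∈ (A.erase v).powerset,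
    indepWeight G lam (insert v I) * (f (insert v I) - f I) ^ 2

/-- The Poincaré inequality with constant `c` for the hardcore model on `A`. -/
def Poincare (A : Finset V) (c : ℝ) : Prop :=
  ∀ f, varForm G lam A f ≤ c * partitionFn G lam A * dirichletForm G lam A f

variable {G lam}

lemma indepWeight_nonneg (h : 0 ≤ lam) (I : Finset V) : 0 ≤ indepWeight G lam I := by
  unfold indepWeight
  split_ifs <;> positivity

lemma indepWeight_empty : indepWeight G lam ∅ = 1 := by
  simp [indepWeight, SimpleGraph.IsIndepSet]

open Classical in
lemma indepWeight_insert {v : V} {I : Finset V} (hv : v ∉ I) :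
    indepWeight G lam (insert v I) =
      if ∀ u ∈ I, ¬ G.Adj v u then lam * indepWeight G lam I else 0 := by
  have key : G.IsIndepSet ((insert v I : Finset V) : Set V) ↔
      (∀ u ∈ I, ¬ G.Adj v u) ∧ G.IsIndepSet (I : Set V) := by
    rw [SimpleGraph.IsIndepSet, Finset.coe_insert, Set.pairwise_insert, and_comm]
    refine and_congr ⟨fun h u hu => (h u hu (by rintro rfl; exact hv hu)).1,
      fun h u hu _ => ⟨h u hu, fun h' => h u hu h'.symm⟩⟩ Iff.rfl
  unfold indepWeight
  rw [Finset.card_insert_of_notMem hv]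
  by_cases h1 : ∀ u ∈ I, ¬ G.Adj v u <;> by_cases h2 : G.IsIndepSet (I : Set V)
  · rw [if_pos (key.2 ⟨h1, h2⟩), if_pos h1, if_pos h2, pow_succ, mul_comm]
  · rw [if_neg (fun h => h2 (key.1 h).2), if_pos h1, if_neg h2, mul_zero]
  · rw [if_neg (fun h => h1 (key.1 h).1), if_neg h1]
  · rw [if_neg (fun h => h1 (key.1 h).1), if_neg h1]

lemma indepWeight_union {A B I J : Finset V} (hd : Disjoint A B)
    (hAB : ∀ a ∈ A, ∀ b ∈ B, ¬ G.Adj a b) (hI : I ⊆ A) (hJ : J ⊆ B) :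
    indepWeight G lam (I ∪ J) = indepWeight G lam I * indepWeight G lam J := by
  have key : G.IsIndepSet ((I ∪ J : Finset V) : Set V) ↔
      G.IsIndepSet (I : Set V) ∧ G.IsIndepSet (J : Set V) := by
    rw [SimpleGraph.IsIndepSet, Finset.coe_union, Set.pairwise_union]
    refine ⟨fun h => ⟨h.1, h.2.1⟩, fun h => ⟨h.1, h.2, fun a ha b hb _ => ?_⟩⟩
    have := hAB a (hI ha) b (hJ hb)
    exact ⟨this, fun h' => this h'.symm⟩
  unfold indepWeight
  rw [Finset.card_union_of_disjoint (Finset.disjoint_of_subset_left hI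
    (Finset.disjoint_of_subset_right hJ hd)), pow_add]
  by_cases h1 : G.IsIndepSet (I : Set V) <;> by_cases h2 : G.IsIndepSet (J : Set V) <;>
    simp only [key, h1, h2, and_self, and_true, and_false, if_true, if_false, mul_zero, zero_mul]

lemma partitionFn_pos (h : 0 ≤ lam) (A : Finset V) : 0 < partitionFn G lam A :=
  Finset.sum_pos' (fun I _ => indepWeight_nonneg h I)
    ⟨∅, by simp, by simp [indepWeight_empty]⟩

lemma dirichletForm_nonneg (h : 0 ≤ lam) (A : Finset V) (f : Finset V → ℝ) :
    0 ≤ dirichletForm G lam A f :=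
  Finset.sum_nonneg fun _ _ => Finset.sum_nonneg fun _ _ =>
    mul_nonneg (indepWeight_nonneg h _) (sq_nonneg _)

lemma Poincare.mono (h : 0 ≤ lam) {A : Finset V} {c c' : ℝ} (hP : Poincare G lam A c)
    (hc : c ≤ c') : Poincare G lam A c' := fun f =>
  (hP f).trans (mul_le_mul_of_nonneg_right
    (mul_le_mul_of_nonneg_right hc (partitionFn_pos h A).le) (dirichletForm_nonneg h A f))

lemma poincare_empty (c : ℝ) : Poincare G lam ∅ c := fun f => by
  simp [varForm, partitionFn, dirichletForm, indepWeight_empty]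

/-- Weighted Cauchy–Schwarz. -/
lemma sq_sum_mul_le {ι : Type*} (s : Finset ι) (a x : ι → ℝ) (ha : ∀ i ∈ s, 0 ≤ a i) :
    (∑ i ∈ s, a i * x i) ^ 2 ≤ (∑ i ∈ s, a i) * ∑ i ∈ s, a i * x i ^ 2 :=
  Finset.sum_sq_le_sum_mul_sum_of_sq_le_mul s ha
    (fun i hi => mul_nonneg (ha i hi) (sq_nonneg _)) (fun i _ => le_of_eq (by ring))

-- An occupied v forces its neighbours to be vacant, so what remains is the hardcore model on the
-- non-neighbours, with an extra factor λ.
open Classical in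
lemma sum_indepWeight_insert {v : V} {A : Finset V} (hv : v ∉ A) (g : Finset V → ℝ) :
    ∑ I ∈ A.powerset, indepWeight G lam (insert v I) * g I =
      lam * ∑ I ∈ (A.filter (fun u => ¬ G.Adj v u)).powerset, indepWeight G lam I * g I := by
  rw [Finset.mul_sum]
  symm
  rw [← Finset.sum_subset (Finset.powerset_mono.2 (Finset.filter_subset (fun u => ¬ G.Adj v u) A))]
  · refine Finset.sum_congr rfl fun I hI => ?_
    rw [Finset.mem_powerset] at hI
    rw [indepWeight_insert (fun h => hv (Finset.mem_filter.1 (hI h)).1),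
      if_pos (fun u hu => (Finset.mem_filter.1 (hI hu)).2)]
    ring
  · intro I hI hI'
    rw [Finset.mem_powerset] at hI hI'
    rw [indepWeight_insert (fun h => hv (hI h)), if_neg, zero_mul]
    exact fun h => hI' fun u hu => Finset.mem_filter.2 ⟨hI hu, h u hu⟩

-- The three terms are the flips of u ≠ v with v vacant, the flips of u ≠ v with v occupied, and the
-- flips of v itself.
open Classical in
lemma dirichletForm_insert_ge (h : 0 ≤ lam) {v : V} {A : Finset V} (hv : v ∉ A)
    (f : Finset V → ℝ) :
    dirichletForm G lam A f
      + lam * dirichletForm G lam (A.filter (fun u => ¬ G.Adj v u)) (fun I => f (insert v I))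
      + lam * ∑ I ∈ (A.filter (fun u => ¬ G.Adj v u)).powerset,
          indepWeight G lam I * (f (insert v I) - f I) ^ 2
      ≤ dirichletForm G lam (insert v A) f := by
  set B := A.filter (fun u => ¬ G.Adj v u) with hB
  have hBA : B ⊆ A := Finset.filter_subset _ _
  rw [dirichletForm.eq_def G lam (insert v A), Finset.sum_insert hv, Finset.erase_insert hv,
    sum_indepWeight_insert hv (fun I => (f (insert v I) - f I) ^ 2)]
  have e : ∑ u ∈ A, ∑ I ∈ ((insert v A).erase u).powerset,
        indepWeight G lam (insert u I) * (f (insert u I) - f I) ^ 2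
      = dirichletForm G lam A f + ∑ u ∈ A, ∑ I ∈ (A.erase u).powerset,
        indepWeight G lam (insert u (insert v I)) *
          (f (insert u (insert v I)) - f (insert v I)) ^ 2 := by
    rw [dirichletForm, ← Finset.sum_add_distrib]
    refine Finset.sum_congr rfl fun u hu => ?_
    have huv : v ≠ u := by rintro rfl; exact hv hu
    rw [Finset.erase_insert_of_ne huv, Finset.sum_powerset_insert]
    exact fun h => hv (Finset.mem_of_mem_erase h)
  rw [e]
  have h2 : lam * dirichletForm G lam B (fun I => f (insert v I)) ≤
      ∑ u ∈ A, ∑ I ∈ (A.erase u).powerset,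
        indepWeight G lam (insert u (insert v I)) *
          (f (insert u (insert v I)) - f (insert v I)) ^ 2 := by
    rw [dirichletForm, Finset.mul_sum]
    refine le_trans (Finset.sum_le_sum (fun u hu => ?_))
      (Finset.sum_le_sum_of_subset_of_nonneg hBA fun u _ _ => Finset.sum_nonneg fun _ _ =>
        mul_nonneg (indepWeight_nonneg h _) (sq_nonneg _))
    rw [Finset.mul_sum]
    refine le_trans (Finset.sum_le_sum (fun I hI => ?_))
      (Finset.sum_le_sum_of_subset_of_nonneg
        (Finset.powerset_mono.2 (Finset.erase_subset_erase u hBA)) fun _ _ _ =>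
          mul_nonneg (indepWeight_nonneg h _) (sq_nonneg _))
    rw [Finset.mem_powerset] at hI
    have hIB : insert u I ⊆ B :=
      Finset.insert_subset hu (hI.trans (Finset.erase_subset _ _))
    rw [Finset.insert_comm u v I,
      indepWeight_insert (v := v) (I := insert u I) (fun h => hv (hBA (hIB h))),
      if_pos (fun w hw => (Finset.mem_filter.1 (hIB hw)).2), mul_assoc]
  linarith

open Classical in
/-- Adding a vertex `v` costs a factor `1 + 2 * lam` in the Poincaré constant. -/
lemma Poincare.insert (h : 0 ≤ lam) {v : V} {A : Finset V} (hv : v ∉ A) {c : ℝ} (hc : 2 ≤ c)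
    (h0 : Poincare G lam A c)
    (h1 : Poincare G lam (A.filter (fun u => ¬ G.Adj v u)) c) :
    Poincare G lam (insert v A) ((1 + 2 * lam) * c) := by
  intro f
  set B := A.filter (fun u => ¬ G.Adj v u) with hB
  have hBA : B ⊆ A := Finset.filter_subset _ _
  have hw := fun I => indepWeight_nonneg (G := G) h I
  have hD := dirichletForm_insert_ge (G := G) h hv f
  have p0 := h0 f
  have p1 := h1 (fun I => f (Insert.insert v I))
  have Z0 := partitionFn_pos (G := G) h A
  have Z1 := partitionFn_pos (G := G) h B
  have D0 := dirichletForm_nonneg (G := G) h A f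
  have D1 := dirichletForm_nonneg (G := G) h B (fun I => f (Insert.insert v I))
  have hZ : partitionFn G lam (Insert.insert v A) =
      partitionFn G lam A + lam * partitionFn G lam B := by
    have := sum_indepWeight_insert (G := G) (lam := lam) hv (fun _ => 1)
    simp only [mul_one] at this
    rw [partitionFn, Finset.sum_powerset_insert hv, this]; rfl
  have hS : ∀ k : ℕ, ∑ I ∈ (Insert.insert v A).powerset, indepWeight G lam I * f I ^ k =
      ∑ I ∈ A.powerset, indepWeight G lam I * f I ^ k +
      lam * ∑ I ∈ B.powerset, indepWeight G lam I * f (Insert.insert v I) ^ k := fun k => by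
    rw [Finset.sum_powerset_insert hv,
      sum_indepWeight_insert hv (fun I => f (Insert.insert v I) ^ k)]
  have hS1 := hS 1
  simp only [pow_one] at hS1
  rw [← hB] at hD
  have c1 := sq_sum_mul_le B.powerset (indepWeight G lam)
    (fun I => f (Insert.insert v I) - f I) (fun I _ => hw I)
  -- m is the mean of f given that v is vacant; y below is the mean given that v is occupied.
  set m := (∑ I ∈ A.powerset, indepWeight G lam I * f I) / partitionFn G lam A with hm
  have c2 := sq_sum_mul_le B.powerset (indepWeight G lam) (fun I => f I - m) (fun I _ => hw I)
  have c3 : ∑ I ∈ B.powerset, indepWeight G lam I * (f I - m) ^ 2 ≤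
      ∑ I ∈ A.powerset, indepWeight G lam I * (f I - m) ^ 2 :=
    Finset.sum_le_sum_of_subset_of_nonneg (Finset.powerset_mono.2 hBA)
      fun _ _ _ => mul_nonneg (hw _) (sq_nonneg _)
  have e3 : ∑ I ∈ A.powerset, indepWeight G lam I * (f I - m) ^ 2 =
      (∑ I ∈ A.powerset, indepWeight G lam I * f I ^ 2)
        - 2 * m * (∑ I ∈ A.powerset, indepWeight G lam I * f I)
        + m ^ 2 * partitionFn G lam A := by
    rw [partitionFn, Finset.mul_sum, Finset.mul_sum, ← Finset.sum_sub_distrib,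
      ← Finset.sum_add_distrib]
    exact Finset.sum_congr rfl fun _ _ => by ring
  have e1 : ∑ I ∈ B.powerset, indepWeight G lam I * (f (Insert.insert v I) - f I) =
      (∑ I ∈ B.powerset, indepWeight G lam I * f (Insert.insert v I)) -
        ∑ I ∈ B.powerset, indepWeight G lam I * f I := by
    rw [← Finset.sum_sub_distrib]
    exact Finset.sum_congr rfl fun _ _ => by ring
  have e2 : ∑ I ∈ B.powerset, indepWeight G lam I * (f I - m) =
      (∑ I ∈ B.powerset, indepWeight G lam I * f I) - m * partitionFn G lam B := by
    rw [partitionFn, Finset.mul_sum, ← Finset.sum_sub_distrib]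
    exact Finset.sum_congr rfl fun _ _ => by ring
  have E0 : 0 ≤ ∑ I ∈ B.powerset, indepWeight G lam I * (f (Insert.insert v I) - f I) ^ 2 :=
    Finset.sum_nonneg fun _ _ => mul_nonneg (hw _) (sq_nonneg _)
  rw [varForm] at p0 p1 ⊢
  rw [hZ, hS 2, hS1]
  rw [e1] at c1
  rw [e2] at c2
  rw [e3] at c3
  change _ ≤ partitionFn G lam B * _ at c1
  change _ ≤ partitionFn G lam B * _ at c2
  have hmz : ∑ I ∈ A.powerset, indepWeight G lam I * f I = m * partitionFn G lam A := by
    rw [hm]; field_simp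
  rw [hmz] at c3 p0 ⊢
  clear_value m
  clear hm hmz e1 e2 e3 hS hS1 hZ hw h0 h1
  generalize dirichletForm G lam (Insert.insert v A) f = DA at *
  generalize dirichletForm G lam A f = d0 at *
  generalize dirichletForm G lam B (fun I => f (Insert.insert v I)) = d1 at *
  generalize partitionFn G lam A = z0 at *
  generalize partitionFn G lam B = z1 at *
  generalize ∑ I ∈ B.powerset, indepWeight G lam I * (f (Insert.insert v I) - f I) ^ 2 = E at *
  generalize ∑ I ∈ B.powerset, indepWeight G lam I * (f I - m) ^ 2 = R at *
  generalize ∑ I ∈ B.powerset, indepWeight G lam I * f (Insert.insert v I) ^ 2 = q1 at *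
  generalize ∑ I ∈ B.powerset, indepWeight G lam I * f (Insert.insert v I) = s1 at *
  generalize ∑ I ∈ B.powerset, indepWeight G lam I * f I = H at *
  generalize ∑ I ∈ A.powerset, indepWeight G lam I * f I ^ 2 = q0 at *
  obtain ⟨y, rfl⟩ : ∃ y, s1 = y * z1 := ⟨s1 / z1, by field_simp⟩
  have hW : q0 - m ^ 2 * z0 ≤ c * d0 := le_of_mul_le_mul_left (by linarith) Z0
  have hU : q1 - y ^ 2 * z1 ≤ c * d1 := le_of_mul_le_mul_left (by linarith) Z1
  have hR : R ≤ q0 - m ^ 2 * z0 := by linarith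
  -- The two means are compared through H, the sum of f over B with v vacant: y - m is the B-average
  -- of f(I ∪ {v}) - f(I) plus the B-average of f - m. Cauchy–Schwarz bounds the two parts by E and
  -- R, and (a + b)² ≤ 2a² + 2b² gives the factor 2.
  have hx : z1 * (y - m) ^ 2 ≤ 2 * (E + R) :=
    le_of_mul_le_mul_left (by nlinarith [sq_nonneg (y * z1 - H - (H - m * z1))]) Z1
  have hZ : z0 ≤ z0 + lam * z1 := le_add_of_nonneg_right (by positivity)
  -- Law of total variance with respect to the status of v.
  calc (z0 + lam * z1) * (q0 + lam * q1) - (m * z0 + lam * (y * z1)) ^ 2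
      = (z0 + lam * z1) * ((q0 - m ^ 2 * z0) + lam * (q1 - y ^ 2 * z1))
          + lam * (z0 * (z1 * (y - m) ^ 2)) := by ring
    _ ≤ (z0 + lam * z1) * (c * d0 + lam * (c * d1))
          + lam * ((z0 + lam * z1) * (2 * (E + c * d0))) := by
        have hx2 : z1 * (y - m) ^ 2 ≤ 2 * (E + c * d0) := by linarith
        have h7 : z0 * (z1 * (y - m) ^ 2) ≤ (z0 + lam * z1) * (2 * (E + c * d0)) :=
          mul_le_mul hZ hx2 (by positivity) (by positivity)
        have h8 : (q0 - m ^ 2 * z0) + lam * (q1 - y ^ 2 * z1) ≤ c * d0 + lam * (c * d1) :=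
          add_le_add hW (mul_le_mul_of_nonneg_left hU h)
        exact add_le_add (mul_le_mul_of_nonneg_left h8 (by positivity))
          (mul_le_mul_of_nonneg_left h7 h)
    _ = (z0 + lam * z1) * ((1 + 2 * lam) * c * d0 + lam * (c * d1) + lam * (2 * E)) := by ring
    _ ≤ (z0 + lam * z1) * ((1 + 2 * lam) * c * DA) := by
        have h5 : c ≤ (1 + 2 * lam) * c := by nlinarith
        refine mul_le_mul_of_nonneg_left ?_ (by positivity)
        calc (1 + 2 * lam) * c * d0 + lam * (c * d1) + lam * (2 * E)
            ≤ (1 + 2 * lam) * c * d0 + lam * ((1 + 2 * lam) * c * d1)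
                + lam * ((1 + 2 * lam) * c * E) := by gcongr; linarith
          _ = (1 + 2 * lam) * c * (d0 + lam * d1 + lam * E) := by ring
          _ ≤ (1 + 2 * lam) * c * DA := mul_le_mul_of_nonneg_left hD (by positivity)
    _ = (1 + 2 * lam) * c * (z0 + lam * z1) * DA := by ring

lemma sum_powerset_union {A B : Finset V} (hd : Disjoint A B) (F : Finset V → ℝ) :
    ∑ K ∈ (A ∪ B).powerset, F K = ∑ I ∈ A.powerset, ∑ J ∈ B.powerset, F (I ∪ J) := by
  induction B using Finset.induction_on generalizing F with
  | empty => simp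
  | insert b B hb ih =>
    rw [Finset.disjoint_insert_right] at hd
    rw [Finset.union_insert, Finset.sum_powerset_insert (by simp [hd.1, hb]), ih hd.2, ih hd.2,
      ← Finset.sum_add_distrib]
    refine Finset.sum_congr rfl fun I _ => ?_
    rw [Finset.sum_powerset_insert hb]
    simp only [Finset.union_insert]

lemma dirichletForm_union {A B : Finset V} (hd : Disjoint A B)
    (hAB : ∀ a ∈ A, ∀ b ∈ B, ¬ G.Adj a b) (f : Finset V → ℝ) :
    dirichletForm G lam (A ∪ B) f =
      ∑ J ∈ B.powerset, indepWeight G lam J * dirichletForm G lam A (fun I => f (I ∪ J)) +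
      ∑ I ∈ A.powerset, indepWeight G lam I * dirichletForm G lam B (fun J => f (I ∪ J)) := by
  rw [dirichletForm, Finset.sum_union hd]
  congr 1
  · simp only [dirichletForm, Finset.mul_sum]
    rw [Finset.sum_comm]
    refine Finset.sum_congr rfl fun v hv => ?_
    have hvB : v ∉ B := Finset.disjoint_left.1 hd hv
    rw [Finset.erase_union_distrib, Finset.erase_eq_of_notMem hvB,
      sum_powerset_union (Finset.disjoint_of_subset_left (Finset.erase_subset _ _) hd),
      Finset.sum_comm]
    refine Finset.sum_congr rfl fun J hJ => Finset.sum_congr rfl fun I hI => ?_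
    rw [Finset.mem_powerset] at hI hJ
    rw [← Finset.insert_union, indepWeight_union hd hAB
      (Finset.insert_subset hv (hI.trans (Finset.erase_subset _ _))) hJ]
    ring
  · simp only [dirichletForm, Finset.mul_sum]
    rw [Finset.sum_comm]
    refine Finset.sum_congr rfl fun v hv => ?_
    have hvA : v ∉ A := Finset.disjoint_right.1 hd hv
    rw [Finset.erase_union_distrib, Finset.erase_eq_of_notMem hvA,
      sum_powerset_union (Finset.disjoint_of_subset_right (Finset.erase_subset _ _) hd)]
    refine Finset.sum_congr rfl fun I hI => Finset.sum_congr rfl fun J hJ => ?_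
    rw [Finset.mem_powerset] at hI hJ
    rw [← Finset.union_insert, indepWeight_union hd hAB hI
      (Finset.insert_subset hv (hJ.trans (Finset.erase_subset _ _)))]
    ring

/-- Tensorization: the Poincaré constant of a disconnected union is the larger of the two. -/
lemma Poincare.union (h : 0 ≤ lam) {A B : Finset V} (hd : Disjoint A B)
    (hAB : ∀ a ∈ A, ∀ b ∈ B, ¬ G.Adj a b) {c : ℝ} (hc : 0 ≤ c)
    (hA : Poincare G lam A c) (hB : Poincare G lam B c) : Poincare G lam (A ∪ B) c := by
  intro f
  have hw := fun I => indepWeight_nonneg (G := G) h I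
  have ZA := partitionFn_pos (G := G) h A
  have ZB := partitionFn_pos (G := G) h B
  have hS : ∀ F : Finset V → ℝ, ∑ K ∈ (A ∪ B).powerset, indepWeight G lam K * F K =
      ∑ J ∈ B.powerset, indepWeight G lam J *
        ∑ I ∈ A.powerset, indepWeight G lam I * F (I ∪ J) := fun F => by
    rw [sum_powerset_union hd, Finset.sum_comm]
    refine Finset.sum_congr rfl fun J hJ => ?_
    rw [Finset.mul_sum]
    refine Finset.sum_congr rfl fun I hI => ?_
    rw [indepWeight_union hd hAB (Finset.mem_powerset.1 hI) (Finset.mem_powerset.1 hJ)]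
    ring
  have hZ : partitionFn G lam (A ∪ B) = partitionFn G lam A * partitionFn G lam B := by
    have := hS (fun _ => 1)
    simp only [mul_one] at this
    rw [partitionFn, this, ← Finset.sum_mul, mul_comm]
    rfl
  set g : Finset V → ℝ := fun J => ∑ I ∈ A.powerset, indepWeight G lam I * f (I ∪ J) with hg
  -- Law of total variance: first over A given J, then over J for the partial sum g.
  have hvar : varForm G lam (A ∪ B) f =
      partitionFn G lam B * ∑ J ∈ B.powerset, indepWeight G lam J *
        varForm G lam A (fun I => f (I ∪ J)) + varForm G lam B g := by
    have e : ∑ J ∈ B.powerset, indepWeight G lam J * varForm G lam A (fun I => f (I ∪ J)) =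
        partitionFn G lam A * ∑ J ∈ B.powerset, indepWeight G lam J *
          ∑ I ∈ A.powerset, indepWeight G lam I * f (I ∪ J) ^ 2
        - ∑ J ∈ B.powerset, indepWeight G lam J * g J ^ 2 := by
      rw [Finset.mul_sum, ← Finset.sum_sub_distrib]
      refine Finset.sum_congr rfl fun J _ => ?_
      rw [varForm]
      ring
    rw [e, varForm, hZ, hS (fun K => f K ^ 2), hS f, varForm]
    ring
  have h1 : ∑ J ∈ B.powerset, indepWeight G lam J * varForm G lam A (fun I => f (I ∪ J)) ≤
      c * partitionFn G lam A * ∑ J ∈ B.powerset, indepWeight G lam J *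
        dirichletForm G lam A (fun I => f (I ∪ J)) := by
    rw [Finset.mul_sum]
    refine Finset.sum_le_sum fun J _ => ?_
    have := mul_le_mul_of_nonneg_left (hA fun I => f (I ∪ J)) (hw J)
    linarith
  -- Averaging over A does not increase the Dirichlet form on B, by Cauchy–Schwarz; the factor is
  -- there because g is not normalized.
  have h2 : dirichletForm G lam B g ≤ partitionFn G lam A *
      ∑ I ∈ A.powerset, indepWeight G lam I * dirichletForm G lam B (fun J => f (I ∪ J)) := by
    simp only [dirichletForm, Finset.mul_sum]
    rw [Finset.sum_comm]
    refine Finset.sum_le_sum fun v _ => ?_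
    rw [Finset.sum_comm]
    refine Finset.sum_le_sum fun J _ => ?_
    have := mul_le_mul_of_nonneg_left (sq_sum_mul_le A.powerset (indepWeight G lam)
      (fun I => f (I ∪ Insert.insert v J) - f (I ∪ J)) fun I _ => hw I)
      (hw (Insert.insert v J))
    simp only [mul_sub, Finset.sum_sub_distrib] at this
    refine this.trans (le_of_eq ?_)
    rw [Finset.mul_sum, Finset.mul_sum]
    refine Finset.sum_congr rfl fun I _ => ?_
    rw [partitionFn]
    ring
  rw [hvar, hZ, dirichletForm_union hd hAB]
  have h3 := mul_le_mul_of_nonneg_left h1 ZB.le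
  have h4 := hB g
  have h5 := mul_le_mul_of_nonneg_left h2 (mul_nonneg hc ZB.le)
  linarith

end Poincare

/-! ### Treedepth, and the Poincaré constant it gives. -/

section TreeDepth

variable {V : Type*} [DecidableEq V]

/-- `TreeDepthLE G A d` bounds the treedepth of the graph induced on `A` by `d`. -/
inductive TreeDepthLE (G : SimpleGraph V) : Finset V → ℕ → Prop
  | empty (d : ℕ) : TreeDepthLE G ∅ d
  | insert {v : V} {A : Finset V} {d : ℕ} (hv : v ∉ A) (h : TreeDepthLE G A d) :
      TreeDepthLE G (insert v A) (d + 1)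
  | union {A B : Finset V} {d : ℕ} (hd : Disjoint A B)
      (hAB : ∀ a ∈ A, ∀ b ∈ B, ¬ G.Adj a b) (hA : TreeDepthLE G A d) (hB : TreeDepthLE G B d) :
      TreeDepthLE G (A ∪ B) d

variable {G : SimpleGraph V}

lemma TreeDepthLE.mono {A : Finset V} {d : ℕ} (h : TreeDepthLE G A d) :
    ∀ {e : ℕ}, d ≤ e → TreeDepthLE G A e := by
  induction h with
  | empty d => exact fun _ => .empty _
  | @insert v A d hv h ih =>
    intro e he
    obtain ⟨k, rfl⟩ := Nat.exists_eq_add_of_le' he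
    rw [← add_assoc]
    exact .insert hv (ih (by omega))
  | union hd hAB _ _ ihA ihB => exact fun he => .union hd hAB (ihA he) (ihB he)

lemma TreeDepthLE.subset {A : Finset V} {d : ℕ} (h : TreeDepthLE G A d) :
    ∀ {B : Finset V}, B ⊆ A → TreeDepthLE G B d := by
  induction h with
  | empty d =>
    intro B hB
    rw [Finset.subset_empty.1 hB]
    exact .empty _
  | @insert v A d hv h ih =>
    intro B hB
    by_cases hvB : v ∈ B
    · rw [← Finset.insert_erase hvB]
      exact .insert (Finset.notMem_erase v B) (ih (Finset.erase_subset_iff_of_mem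
        (Finset.mem_insert_self v A) |>.2 hB |> fun h => Finset.subset_insert_iff.1 hB))
    · exact (ih ((Finset.subset_insert_iff_of_notMem hvB).1 hB)).mono (Nat.le_succ d)
  | @union A₁ A₂ d hd hAB _ _ ihA ihB =>
    intro B hB
    have : B = B ∩ A₁ ∪ B ∩ A₂ := by
      rw [← Finset.inter_union_distrib_left, Finset.inter_eq_left.2 hB]
    rw [this]
    exact .union (Finset.disjoint_of_subset_left Finset.inter_subset_right
        (Finset.disjoint_of_subset_right Finset.inter_subset_right hd))
      (fun a ha b hb => hAB a (Finset.mem_inter.1 ha).2 b (Finset.mem_inter.1 hb).2)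
      (ihA Finset.inter_subset_right) (ihB Finset.inter_subset_right)

lemma TreeDepthLE.union_left {A : Finset V} {d : ℕ} (h : TreeDepthLE G A d) (X : Finset V) :
    TreeDepthLE G (X ∪ A) (d + X.card) := by
  induction X using Finset.induction_on with
  | empty => simpa using h
  | insert x X hx ih =>
    rw [Finset.insert_union, Finset.card_insert_of_notMem hx, ← add_assoc]
    by_cases hxA : x ∈ X ∪ A
    · rw [Finset.insert_eq_self.2 hxA]
      exact ih.mono (Nat.le_succ _)
    · exact .insert hxA ih

/-- No edge joins different label classes, so they can be united one at a time at no cost in depth.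
-/
lemma TreeDepthLE.of_labels {ι : Type*} [DecidableEq ι] (L : V → ι) {d : ℕ} (A : Finset V)
    (hL : ∀ a ∈ A, ∀ b ∈ A, G.Adj a b → L a = L b)
    (h : ∀ i, TreeDepthLE G (A.filter fun v => L v = i) d) : TreeDepthLE G A d := by
  have key : ∀ s : Finset ι, TreeDepthLE G (A.filter fun v => L v ∈ s) d := by
    intro s
    induction s using Finset.induction_on with
    | empty => simpa using TreeDepthLE.empty d
    | insert i s hi ih =>
      have e : A.filter (fun v => L v ∈ Insert.insert i s) =
          A.filter (fun v => L v = i) ∪ A.filter (fun v => L v ∈ s) := by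
        rw [← Finset.filter_or]
        simp only [Finset.mem_insert]
      rw [e]
      refine .union ?_ ?_ (h i) ih
      · rw [Finset.disjoint_filter]
        rintro v _ rfl h'
        exact hi h'
      · intro a ha b hb hab
        rw [Finset.mem_filter] at ha hb
        rw [← hL a ha.1 b hb.1 hab, ha.2] at hb
        exact hi hb.2
  refine (key (A.image L)).subset fun v hv => ?_
  exact Finset.mem_filter.2 ⟨hv, Finset.mem_image_of_mem L hv⟩

open Classical in
lemma TreeDepthLE.poincare {lam : ℝ} (h : 0 ≤ lam) {A : Finset V} {d : ℕ}
    (hA : TreeDepthLE G A d) : Poincare G lam A (2 * (1 + 2 * lam) ^ d) := by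
  -- The induction runs over all subsets because inserting v also needs the inequality on the
  -- non-neighbours of v.
  have key : ∀ B ⊆ A, Poincare G lam B (2 * (1 + 2 * lam) ^ d) := by
    induction hA with
    | empty d =>
      intro B hB
      rw [Finset.subset_empty.1 hB]
      exact poincare_empty _
    | @insert v A d hv _ ih =>
      have h1 : (1 : ℝ) ≤ (1 + 2 * lam) ^ d := one_le_pow₀ (by linarith)
      intro B hB
      by_cases hvB : v ∈ B
      · have hsub : B.erase v ⊆ A := Finset.subset_insert_iff.1 hB
        have := Poincare.insert h (Finset.notMem_erase v B) (by linarith) (ih _ hsub)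
          (ih _ ((Finset.filter_subset _ _).trans hsub))
        rw [Finset.insert_erase hvB] at this
        rw [pow_succ]
        convert this using 1
        ring
      · refine (ih _ ((Finset.subset_insert_iff_of_notMem hvB).1 hB)).mono h ?_
        rw [pow_succ]
        nlinarith
    | @union A₁ A₂ d hd hAB _ _ ihA ihB =>
      intro B hB
      have : B = B ∩ A₁ ∪ B ∩ A₂ := by
        rw [← Finset.inter_union_distrib_left, Finset.inter_eq_left.2 hB]
      rw [this]
      exact .union h (Finset.disjoint_of_subset_left Finset.inter_subset_right
          (Finset.disjoint_of_subset_right Finset.inter_subset_right hd))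
        (fun a ha b hb => hAB a (Finset.mem_inter.1 ha).2 b (Finset.mem_inter.1 hb).2)
        (by positivity)
        (ihA _ Finset.inter_subset_right) (ihB _ Finset.inter_subset_right)
  exact key A subset_rfl

end TreeDepth

/-! ### Balanced separators from tree decompositions. -/

section Separator

variable {V : Type*} {G : SimpleGraph V}

namespace TreeDecomposition

variable (D : TreeDecomposition G)

open Classical in
/-- The component of `tree - i` containing the nodes whose bags contain `v`, if `v ∉ bag i`. -/
noncomputable def label (i : Fin D.m) (v : V) :
    Option (D.tree.induce {k | k ≠ i}).ConnectedComponent :=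
  if h : v ∈ D.bag i then none
  else some ((D.tree.induce {k | k ≠ i}).connectedComponentMk
    ⟨(D.vertex_mem v).choose, fun e => h (e ▸ (D.vertex_mem v).choose_spec)⟩)

/-- The nodes whose bags contain v are connected and avoid i, so they lie in a single component and
the chosen node does not matter. -/
lemma label_eq {i k : Fin D.m} {v : V} (hi : v ∉ D.bag i) (hk : v ∈ D.bag k) :
    D.label i v = some ((D.tree.induce {k | k ≠ i}).connectedComponentMk
      ⟨k, fun e => hi (e ▸ hk)⟩) := by
  rw [label, dif_neg hi]
  congr 1
  rw [SimpleGraph.ConnectedComponent.eq]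
  have hsub : {k | v ∈ D.bag k} ⊆ {k | k ≠ i} := fun k hk e => hi (e ▸ hk)
  exact ((D.connected v).preconnected ⟨_, (D.vertex_mem v).choose_spec⟩ ⟨k, hk⟩).map
    (SimpleGraph.induceHomOfLE D.tree hsub).toHom

lemma label_adj {i : Fin D.m} {u v : V} (hu : u ∉ D.bag i) (hv : v ∉ D.bag i)
    (huv : G.Adj u v) : D.label i u = D.label i v := by
  obtain ⟨k, hku, hkv⟩ := D.edge_mem u v huv
  rw [D.label_eq hu hku, D.label_eq hv hkv]

lemma exists_adj_component (i : Fin D.m) (k : Fin D.m) (hk : k ≠ i) :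
    ∃ j, ∃ h : D.tree.Adj i j, (D.tree.induce {k | k ≠ i}).connectedComponentMk ⟨j, h.ne'⟩ =
      (D.tree.induce {k | k ≠ i}).connectedComponentMk ⟨k, hk⟩ := by
  obtain ⟨p, hp⟩ := D.isTree.connected.exists_isPath i k
  cases p with
  | nil => exact absurd rfl hk
  | @cons _ j _ h p =>
    rw [SimpleGraph.Walk.cons_isPath_iff] at hp
    refine ⟨j, h, SimpleGraph.ConnectedComponent.eq.2 ?_⟩
    exact ⟨p.induce _ fun x hx (e : x = i) => hp.2 (e ▸ hx)⟩

/-- Walks avoiding i or avoiding j do not use the edge ij. Together they would join i to j without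
it, but every edge of a tree is a bridge. -/
lemma not_both_sides {i j k : Fin D.m} (hij : D.tree.Adj i j) (hki : k ≠ i) (hkj : k ≠ j)
    (h1 : (D.tree.induce {k | k ≠ i}).Reachable ⟨j, hij.ne'⟩ ⟨k, hki⟩)
    (h2 : (D.tree.induce {k | k ≠ j}).Reachable ⟨i, hij.ne⟩ ⟨k, hkj⟩) : False := by
  have hb := SimpleGraph.isAcyclic_iff_forall_adj_isBridge.1 D.isTree.isAcyclic hij
  rw [SimpleGraph.isBridge_iff] at hb
  refine hb ((h2.map ⟨Subtype.val, fun {a b} hab => ?_⟩).trans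
    (h1.map ⟨Subtype.val, fun {a b} hab => ?_⟩).symm)
  all_goals
    rw [SimpleGraph.deleteEdges_adj]
    refine ⟨hab, fun he => ?_⟩
    have ha := a.2
    have hb := b.2
    simp only [Set.mem_ofPred_eq] at ha hb
    rcases Sym2.eq_iff.1 (Set.mem_singleton_iff.1 he) with h | h
    · first | exact ha h.1 | exact hb h.2
    · first | exact ha h.1 | exact hb h.2

open Classical in
/-- Every set of vertices has a bag that splits it into parts of at most half its size. -/
lemma exists_balanced (A : Finset V) :
    ∃ i, ∀ c, 2 * (A.filter fun v => D.label i v = some c).card ≤ A.card := by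
  by_contra! hcon
  choose c hc using hcon
  have hadj : ∀ i, ∃ j, ∃ h : D.tree.Adj i j,
      (D.tree.induce {k | k ≠ i}).connectedComponentMk ⟨j, h.ne'⟩ = c i := by
    intro i
    induction hci : c i using SimpleGraph.ConnectedComponent.ind with
    | h k => exact D.exists_adj_component i k.1 k.2
  choose nb hnb hcomp using hadj
  -- Each node points along an edge towards its heavy component. A tree has fewer edges than nodes,
  -- so two nodes use the same edge, pointing at each other.
  have hcard : D.tree.edgeFinset.card < (Finset.univ : Finset (Fin D.m)).card := by
    have := D.isTree.card_edgeFinset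
    rw [Finset.card_univ]
    omega
  obtain ⟨i, -, j, -, hne, he⟩ := Finset.exists_ne_map_eq_of_card_lt_of_maps_to hcard
    (f := fun i => s(i, nb i)) (fun i _ => by simpa using hnb i)
  obtain ⟨h1, h2⟩ : i = nb j ∧ nb i = j := by
    rcases Sym2.eq_iff.1 he with h | h
    · exact absurd h.1 hne
    · exact h
  subst h2
  -- Both heavy parts hold more than half of A, so they share a vertex, which would lie on both
  -- sides of the edge.
  have hlt : A.card < (A.filter fun v => D.label i v = some (c i)).card +
      (A.filter fun v => D.label (nb i) v = some (c (nb i))).card := by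
    have := hc i
    have := hc (nb i)
    omega
  obtain ⟨v, hv⟩ := Finset.inter_nonempty_of_card_lt_card_add_card
    (Finset.filter_subset _ _) (Finset.filter_subset _ _) hlt
  rw [Finset.mem_inter, Finset.mem_filter, Finset.mem_filter] at hv
  have hvi : v ∉ D.bag i := fun h => by simp [label, h] at hv
  have hvj : v ∉ D.bag (nb i) := fun h => by simp [label, h] at hv
  obtain ⟨k, hk⟩ := D.vertex_mem v
  rw [D.label_eq hvi hk, D.label_eq hvj hk, ← hcomp i, ← hcomp (nb i), Option.some_inj,
    Option.some_inj, SimpleGraph.ConnectedComponent.eq, SimpleGraph.ConnectedComponent.eq] at hv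
  refine D.not_both_sides (hnb i) (fun e => hvi (e ▸ hk)) (fun e => hvj (e ▸ hk)) hv.1.2.symm ?_
  convert hv.2.2.symm

-- Deleting a balanced bag costs at most s in depth and halves the size, so k rounds exhaust a set
-- of fewer than 2 ^ k vertices.
open Classical in
lemma treeDepthLE_of_card_bag_le [DecidableEq V] {s : ℕ} (hD : ∀ i, (D.bag i).card ≤ s) (k : ℕ) :
    ∀ A : Finset V, A.card < 2 ^ k → TreeDepthLE G A (k * s) := by
  induction k with
  | zero =>
    intro A hA
    rw [Finset.card_eq_zero.1 (by simpa using hA : A.card = 0)]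
    exact .empty _
  | succ k ih =>
    intro A hA
    obtain ⟨i, hi⟩ := D.exists_balanced A
    have hpart : TreeDepthLE G (A \ D.bag i) (k * s) := by
      refine TreeDepthLE.of_labels (D.label i) _ (fun a ha b hb hab => ?_) fun c => ?_
      · exact D.label_adj (Finset.mem_sdiff.1 ha).2 (Finset.mem_sdiff.1 hb).2 hab
      · cases c with
        | none =>
          rw [Finset.filter_false_of_mem fun v hv => by
            simp [label, (Finset.mem_sdiff.1 hv).2]]
          exact .empty _
        | some c =>
          refine (ih _ ?_).subset (Finset.filter_subset_filter _ Finset.sdiff_subset)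
          have := hi c
          rw [pow_succ] at hA
          omega
    have := (hpart.union_left (D.bag i)).mono
      (show k * s + (D.bag i).card ≤ (k + 1) * s by have := hD i; rw [add_mul]; omega)
    exact this.subset fun v hv => by
      by_cases h : v ∈ D.bag i <;> simp [h, hv]

end TreeDecomposition

lemma exists_treeDecomposition_width_eq [Finite V] {t : ℕ} (ht : 1 ≤ t)
    (h : treewidth G = t) : ∃ D : TreeDecomposition G, D.width = t := by
  -- The infimum of the empty set is 0, which t ≥ 1 excludes.
  have hne : (Set.range fun D : TreeDecomposition G => D.width).Nonempty := by
    by_contra hne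
    rw [treewidth, Set.not_nonempty_iff_eq_empty.1 hne, Nat.sInf_empty] at h
    omega
  obtain ⟨D, hD⟩ := Nat.sInf_mem hne
  exact ⟨D, hD.trans h⟩

lemma exists_treeDecomposition_card_bag_le [Finite V] {t : ℕ} (ht : 1 ≤ t)
    (h : treewidth G = t) : ∃ D : TreeDecomposition G, ∀ i, (D.bag i).card ≤ t + 1 := by
  obtain ⟨D, h1⟩ := exists_treeDecomposition_width_eq ht h
  refine ⟨D, fun i => ?_⟩
  have h2 := Finset.le_sup (f := fun i => (D.bag i).card) (Finset.mem_univ i)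
  rw [TreeDecomposition.width] at h1
  omega

lemma two_le_card_of_treewidth [Fintype V] {t : ℕ} (ht : 1 ≤ t) (h : treewidth G = t) :
    2 ≤ Fintype.card V := by
  by_contra hcon
  obtain ⟨D, h1⟩ := exists_treeDecomposition_width_eq ht h
  rw [TreeDecomposition.width] at h1
  have h2 : (Finset.univ.sup fun i => (D.bag i).card) ≤ 1 :=
    Finset.sup_le fun i _ => (Finset.card_le_univ _).trans (by omega)
  omega

end Separator

/-! ### Glauber dynamics: reversibility, variance decay and mixing. -/

section SiteConditional

variable {V Q : Type*} [DecidableEq V] [Fintype Q] {μ : (V → Q) → ℝ}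

lemma siteConditional_nonneg (hμ : ∀ σ, 0 ≤ μ σ) (v : V) (σ : V → Q) (q : Q) :
    0 ≤ siteConditional μ v σ q :=
  div_nonneg (hμ _) (Finset.sum_nonneg fun _ _ => hμ _)

lemma sum_siteConditional (hμ : ∀ σ, 0 ≤ μ σ) (v : V) {σ : V → Q} (hσ : 0 < μ σ) :
    ∑ q, siteConditional μ v σ q = 1 := by
  simp only [siteConditional]
  rw [← Finset.sum_div]
  refine div_self (ne_of_gt ?_)
  exact Finset.sum_pos' (fun _ _ => hμ _) ⟨σ v, Finset.mem_univ _, by simpa using hσ⟩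

end SiteConditional

section GlauberMixing

variable {V Q : Type*} [Fintype V] [DecidableEq V] [Fintype Q] [DecidableEq Q]
  {μ : (V → Q) → ℝ}

/-- The operator that resamples the spin of `v`, applied to an observable. -/
noncomputable def siteAverage (μ : (V → Q) → ℝ) (v : V) (h : (V → Q) → ℝ) (σ : V → Q) : ℝ :=
  ∑ q, siteConditional μ v σ q * h (Function.update σ v q)

lemma sum_agree_off (v : V) (σ : V → Q) (F : (V → Q) → ℝ) :
    ∑ τ : V → Q, (if ∀ w, w ≠ v → τ w = σ w then F τ else 0) =
      ∑ q, F (Function.update σ v q) := by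
  rw [← Finset.sum_filter]
  symm
  refine Finset.sum_bij (fun q _ => Function.update σ v q) ?_ ?_ ?_ ?_
  · intro q _
    simp +contextual [Function.update_of_ne]
  · intro q _ q' _ h
    exact Function.update_injective σ v h
  · intro τ hτ
    refine ⟨τ v, Finset.mem_univ _, ?_⟩
    ext w
    by_cases hw : w = v
    · subst hw; simp
    · rw [Function.update_of_ne hw, (Finset.mem_filter.1 hτ).2 w hw]
  · exact fun _ _ => rfl

lemma glauberMatrix_mulVec (h : (V → Q) → ℝ) (σ : V → Q) :
    (glauberMatrix μ).mulVec h σ = (1 / (Fintype.card V : ℝ)) * ∑ v, siteAverage μ v h σ := by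
  simp only [Matrix.mulVec, dotProduct, glauberMatrix, Matrix.of_apply, Finset.sum_mul]
  rw [Finset.sum_comm, Finset.mul_sum]
  refine Finset.sum_congr rfl fun v _ => ?_
  have e : siteAverage μ v h σ = _ :=
    ((sum_agree_off v σ fun τ => siteConditional μ v σ (τ v) * h τ).trans
      (by simp [siteAverage])).symm
  rw [e, Finset.mul_sum]
  refine Finset.sum_congr rfl fun τ _ => ?_
  split_ifs <;> ring

lemma glauberMatrix_nonneg (hμ : ∀ σ, 0 ≤ μ σ) (σ τ : V → Q) : 0 ≤ glauberMatrix μ σ τ := by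
  refine Finset.sum_nonneg fun v _ => mul_nonneg (by positivity) ?_
  split_ifs
  · exact siteConditional_nonneg hμ _ _ _
  · exact le_rfl

lemma glauberMatrix_reversible (σ τ : V → Q) :
    μ σ * glauberMatrix μ σ τ = μ τ * glauberMatrix μ τ σ := by
  simp only [glauberMatrix, Matrix.of_apply, Finset.mul_sum]
  refine Finset.sum_congr rfl fun v _ => ?_
  by_cases h : ∀ w, w ≠ v → τ w = σ w
  · rw [if_pos h, if_pos fun w hw => (h w hw).symm]
    have h1 : ∀ q, Function.update σ v q = Function.update τ v q := by
      intro q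
      ext w
      by_cases hw : w = v
      · subst hw; simp
      · rw [Function.update_of_ne hw, Function.update_of_ne hw, h w hw]
    simp only [siteConditional, h1]
    rw [← h1 (σ v)]
    simp only [Function.update_eq_self]
    ring
  · rw [if_neg h, if_neg fun h' => h fun w hw => (h' w hw).symm]
    ring

lemma glauberMatrix_pow_reversible (s : ℕ) (σ τ : V → Q) :
    μ σ * (glauberMatrix μ ^ s) σ τ = μ τ * (glauberMatrix μ ^ s) τ σ := by
  induction s generalizing σ τ with
  | zero =>
    by_cases h : σ = τ
    · subst h; rfl
    · simp [Matrix.one_apply_ne h, Matrix.one_apply_ne (Ne.symm h)]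
  | succ s ih =>
    rw [pow_succ, Matrix.mul_apply, Finset.mul_sum, ← pow_succ, pow_succ', Matrix.mul_apply,
      Finset.mul_sum]
    refine Finset.sum_congr rfl fun ρ _ => ?_
    rw [← mul_assoc, ih, mul_right_comm, glauberMatrix_reversible, mul_assoc]

lemma glauberMatrix_pow_nonneg (hμ : ∀ σ, 0 ≤ μ σ) (s : ℕ) (σ τ : V → Q) :
    0 ≤ (glauberMatrix μ ^ s) σ τ := by
  induction s generalizing σ τ with
  | zero =>
    rw [pow_zero, Matrix.one_apply]
    split_ifs <;> norm_num
  | succ s ih =>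
    rw [pow_succ, Matrix.mul_apply]
    exact Finset.sum_nonneg fun ρ _ => mul_nonneg (ih _ _) (glauberMatrix_nonneg hμ _ _)

lemma glauberMatrix_row_sum [Nonempty V] (hμ : ∀ σ, 0 ≤ μ σ) {σ : V → Q} (hσ : 0 < μ σ) :
    ∑ τ, glauberMatrix μ σ τ = 1 := by
  have := glauberMatrix_mulVec (μ := μ) (fun _ => 1) σ
  simp only [Matrix.mulVec, dotProduct, mul_one] at this
  rw [this]
  have h1 : ∀ v, siteAverage μ v (fun _ => 1) σ = 1 := fun v => by
    simp only [siteAverage, mul_one]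
    exact sum_siteConditional hμ v hσ
  simp [h1]

/-- The Gibbs distribution is stationary. -/
lemma sum_mul_glauberMatrix_mulVec [Nonempty V] (hμ : ∀ σ, 0 ≤ μ σ) (h : (V → Q) → ℝ) :
    ∑ σ, μ σ * (glauberMatrix μ).mulVec h σ = ∑ σ, μ σ * h σ := by
  simp only [Matrix.mulVec, dotProduct, Finset.mul_sum]
  rw [Finset.sum_comm]
  refine Finset.sum_congr rfl fun τ _ => ?_
  simp only [← mul_assoc, glauberMatrix_reversible _ τ]
  rw [← Finset.sum_mul, ← Finset.mul_sum]
  rcases (hμ τ).eq_or_lt with h0 | h0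
  · simp [← h0]
  · rw [glauberMatrix_row_sum hμ h0, mul_one]

lemma sum_mul_glauberMatrix_pow_mulVec [Nonempty V] (hμ : ∀ σ, 0 ≤ μ σ) (h : (V → Q) → ℝ)
    (s : ℕ) : ∑ σ, μ σ * (glauberMatrix μ ^ s).mulVec h σ = ∑ σ, μ σ * h σ := by
  induction s with
  | zero => simp
  | succ s ih =>
    rw [pow_succ', ← Matrix.mulVec_mulVec, sum_mul_glauberMatrix_mulVec hμ, ih]

lemma glauberMatrix_mulVec_sq_le [Nonempty V] (h : (V → Q) → ℝ) (σ : V → Q) :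
    (glauberMatrix μ).mulVec h σ ^ 2 ≤
      (1 / (Fintype.card V : ℝ)) * ∑ v, siteAverage μ v h σ ^ 2 := by
  have hn : (0 : ℝ) < Fintype.card V := by exact_mod_cast Fintype.card_pos
  rw [glauberMatrix_mulVec]
  have := sq_sum_le_card_mul_sum_sq (s := (Finset.univ : Finset V))
    (f := fun v => siteAverage μ v h σ)
  rw [Finset.card_univ] at this
  rw [mul_pow, div_pow, one_pow, div_mul_eq_mul_div, div_mul_eq_mul_div, one_mul, one_mul,
    div_le_div_iff₀ (by positivity) hn]
  nlinarith

/-- `PoincareGlauber μ γ`: the Glauber dynamics for `μ` satisfies a Poincaré inequality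
with constant `γ`. -/
def PoincareGlauber (μ : (V → Q) → ℝ) (γ : ℝ) : Prop :=
  ∀ h : (V → Q) → ℝ, γ * (∑ σ, μ σ * h σ ^ 2 - (∑ σ, μ σ * h σ) ^ 2) ≤
    (1 / (Fintype.card V : ℝ)) * ∑ v, ∑ σ, μ σ * (h σ ^ 2 - siteAverage μ v h σ ^ 2)

/-- By convexity the second moment after a step is at most the average of those after the
single-site resamplings, and the Dirichlet form in `PoincareGlauber` is exactly the loss to that
average. No spectral theory is needed. -/
lemma PoincareGlauber.variance_step [Nonempty V] (hμ : ∀ σ, 0 ≤ μ σ) {γ : ℝ}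
    (hP : PoincareGlauber μ γ) (h : (V → Q) → ℝ) :
    ∑ σ, μ σ * (glauberMatrix μ).mulVec h σ ^ 2
        - (∑ σ, μ σ * (glauberMatrix μ).mulVec h σ) ^ 2 ≤
      (1 - γ) * (∑ σ, μ σ * h σ ^ 2 - (∑ σ, μ σ * h σ) ^ 2) := by
  have hn : (0 : ℝ) < Fintype.card V := by exact_mod_cast Fintype.card_pos
  rw [sum_mul_glauberMatrix_mulVec hμ]
  have h1 : ∑ σ, μ σ * (glauberMatrix μ).mulVec h σ ^ 2 ≤
      ∑ σ, μ σ * ((1 / (Fintype.card V : ℝ)) * ∑ v, siteAverage μ v h σ ^ 2) :=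
    Finset.sum_le_sum fun σ _ =>
      mul_le_mul_of_nonneg_left (glauberMatrix_mulVec_sq_le h σ) (hμ σ)
  have h2 : (1 / (Fintype.card V : ℝ)) *
        ∑ v, ∑ σ, μ σ * (h σ ^ 2 - siteAverage μ v h σ ^ 2) =
      ∑ σ, μ σ * h σ ^ 2 -
        ∑ σ, μ σ * ((1 / (Fintype.card V : ℝ)) * ∑ v, siteAverage μ v h σ ^ 2) := by
    rw [Finset.sum_comm, Finset.mul_sum, ← Finset.sum_sub_distrib]
    refine Finset.sum_congr rfl fun σ _ => ?_
    rw [← Finset.mul_sum, Finset.sum_sub_distrib, Finset.sum_const, Finset.card_univ,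
      nsmul_eq_mul]
    field_simp
  have := hP h
  linarith

lemma PoincareGlauber.variance_pow [Nonempty V] (hμ : ∀ σ, 0 ≤ μ σ) {γ : ℝ} (hγ : γ ≤ 1)
    (hP : PoincareGlauber μ γ) (h : (V → Q) → ℝ) (s : ℕ) :
    ∑ σ, μ σ * (glauberMatrix μ ^ s).mulVec h σ ^ 2 - (∑ σ, μ σ * h σ) ^ 2 ≤
      (1 - γ) ^ s * (∑ σ, μ σ * h σ ^ 2 - (∑ σ, μ σ * h σ) ^ 2) := by
  induction s with
  | zero => simp
  | succ s ih =>
    have := hP.variance_step hμ ((glauberMatrix μ ^ s).mulVec h)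
    rw [Matrix.mulVec_mulVec, ← pow_succ', sum_mul_glauberMatrix_pow_mulVec hμ,
      sum_mul_glauberMatrix_pow_mulVec hμ] at this
    refine this.trans ?_
    rw [show (1 - γ) ^ (s + 1) = (1 - γ) * (1 - γ) ^ s from pow_succ' _ _, mul_assoc]
    exact mul_le_mul_of_nonneg_left ih (by linarith)

/-- A Poincaré inequality gives exponential decay of the total variation distance. -/
lemma PoincareGlauber.tvDist_sq_le [Nonempty V] (hμ : ∀ σ, 0 ≤ μ σ) (hsum : ∑ σ, μ σ = 1)
    {γ : ℝ} (hγ : γ ≤ 1) (hP : PoincareGlauber μ γ) {σ : V → Q} (hσ : 0 < μ σ) (s : ℕ) :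
    tvDist ((glauberMatrix μ ^ s) σ) μ ^ 2 ≤ (1 - γ) ^ s / (4 * μ σ) := by
  -- The density of the point mass at σ relative to μ. By reversibility h is the density after s
  -- steps, and Cauchy–Schwarz bounds total variation by its variance.
  set δ : (V → Q) → ℝ := Pi.single σ (μ σ)⁻¹ with hδ
  set h := (glauberMatrix μ ^ s).mulVec δ with hh
  have e1 : ∀ τ, (glauberMatrix μ ^ s) σ τ = μ τ * h τ := fun τ => by
    rw [hh, hδ, Matrix.mulVec_single]
    simp only [MulOpposite.smul_eq_mul_unop, Matrix.col_apply, Pi.smul_apply, MulOpposite.unop_op]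
    rw [← mul_assoc, ← glauberMatrix_pow_reversible]
    field_simp
  have e2 : ∑ τ, μ τ * δ τ = 1 := by
    rw [Finset.sum_eq_single σ (fun τ _ hτ => by simp [hδ, Pi.single_eq_of_ne hτ]) (by simp)]
    rw [hδ, Pi.single_eq_same]
    field_simp
  have e3 : ∑ τ, μ τ * δ τ ^ 2 = (μ σ)⁻¹ := by
    rw [Finset.sum_eq_single σ (fun τ _ hτ => by simp [hδ, Pi.single_eq_of_ne hτ]) (by simp)]
    rw [hδ, Pi.single_eq_same]
    field_simp
  have e4 : ∑ τ, μ τ * h τ = 1 := by rw [hh, sum_mul_glauberMatrix_pow_mulVec hμ, e2]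
  have hv := hP.variance_pow hμ hγ δ s
  rw [e2, e3] at hv
  have hcs := sq_sum_mul_le Finset.univ μ (fun τ => |h τ - 1|) (fun τ _ => hμ τ)
  have e5 : ∑ τ, |(glauberMatrix μ ^ s) σ τ - μ τ| = ∑ τ, μ τ * |h τ - 1| :=
    Finset.sum_congr rfl fun τ _ => by
      rw [e1, ← abs_of_nonneg (hμ τ), ← abs_mul, abs_of_nonneg (hμ τ), mul_sub, mul_one]
  have e6 : ∑ τ, μ τ * |h τ - 1| ^ 2 = ∑ τ, μ τ * h τ ^ 2 - 1 := by
    have : ∀ τ, μ τ * |h τ - 1| ^ 2 = μ τ * h τ ^ 2 - 2 * (μ τ * h τ) + μ τ := fun τ => by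
      rw [sq_abs]; ring
    simp only [this]
    rw [Finset.sum_add_distrib, Finset.sum_sub_distrib, ← Finset.mul_sum, e4, hsum]
    ring
  rw [e6, hsum, one_mul] at hcs
  rw [tvDist, e5, mul_pow]
  have h0 : 0 ≤ (1 - γ) ^ s := pow_nonneg (by linarith) s
  have h1 : (1 - γ) ^ s / (4 * μ σ) = 1 / 4 * ((1 - γ) ^ s * (μ σ)⁻¹) := by
    field_simp
  rw [h1]
  nlinarith

lemma glauberMatrix_pow_row_sum [Nonempty V] (hμ : ∀ σ, 0 ≤ μ σ) {σ : V → Q} (hσ : 0 < μ σ)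
    (s : ℕ) : ∑ τ, (glauberMatrix μ ^ s) σ τ = 1 := by
  have h := sum_mul_glauberMatrix_pow_mulVec hμ (Pi.single σ 1) s
  have h1 : ∀ τ, (glauberMatrix μ ^ s).mulVec (Pi.single σ 1) τ = (glauberMatrix μ ^ s) τ σ :=
    fun τ => by simp
  simp only [h1, ← glauberMatrix_pow_reversible s σ] at h
  have h2 : ∑ τ, μ τ * (Pi.single σ 1 : (V → Q) → ℝ) τ = μ σ * 1 := by
    rw [Finset.sum_eq_single σ (fun τ _ hτ => by simp [Pi.single_eq_of_ne hτ]) (by simp),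
      Pi.single_eq_same]
  rw [← Finset.mul_sum, h2] at h
  exact mul_left_cancel₀ hσ.ne' h

/-- If one step of the dynamics contracts `φ` up to an additive error, then so do `s` steps. -/
lemma glauberMatrix_pow_mulVec_le [Nonempty V] (hμ : ∀ σ, 0 ≤ μ σ) {φ : (V → Q) → ℝ} {r b : ℝ}
    (hr : 0 ≤ r) (hφ : ∀ σ, (glauberMatrix μ).mulVec φ σ ≤ r * φ σ + (1 - r) * b)
    (hb : 0 ≤ b) {σ : V → Q} (hσ : 0 < μ σ) (s : ℕ) :
    (glauberMatrix μ ^ s).mulVec φ σ ≤ r ^ s * φ σ + b := by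
  induction s with
  | zero => simpa using hb
  | succ s ih =>
    have h1 : (glauberMatrix μ ^ (s + 1)).mulVec φ σ ≤
        (glauberMatrix μ ^ s).mulVec (fun τ => r * φ τ + (1 - r) * b) σ := by
      rw [pow_succ, ← Matrix.mulVec_mulVec]
      exact Finset.sum_le_sum fun τ _ =>
        mul_le_mul_of_nonneg_left (hφ τ) (glauberMatrix_pow_nonneg hμ s σ τ)
    have h2 : (glauberMatrix μ ^ s).mulVec (fun τ => r * φ τ + (1 - r) * b) σ =
        r * (glauberMatrix μ ^ s).mulVec φ σ + (1 - r) * b := by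
      calc (glauberMatrix μ ^ s).mulVec (fun τ => r * φ τ + (1 - r) * b) σ
          = r * (glauberMatrix μ ^ s).mulVec φ σ
              + (∑ τ, (glauberMatrix μ ^ s) σ τ) * ((1 - r) * b) := by
            simp only [Matrix.mulVec, dotProduct, Finset.mul_sum, Finset.sum_mul]
            rw [← Finset.sum_add_distrib]
            exact Finset.sum_congr rfl fun τ _ => by ring
        _ = _ := by rw [glauberMatrix_pow_row_sum hμ hσ, one_mul]
    rw [h2] at h1
    have h3 := mul_le_mul_of_nonneg_left ih hr
    rw [show r ^ (s + 1) = r * r ^ s from pow_succ' _ _]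
    linarith

end GlauberMixing

/-! ### Total variation for distributions concentrated on one point. -/

section TotalVariation

variable {X : Type*} [Fintype X]

lemma tvDist_le_of_atom {p q : X → ℝ} (hp : ∀ x, 0 ≤ p x) (hq : ∀ x, 0 ≤ q x)
    (hp1 : ∑ x, p x = 1) (hq1 : ∑ x, q x = 1) (e : X) :
    tvDist p q ≤ (1 - p e) + (1 - q e) := by
  classical
  have h1 := Finset.add_sum_erase Finset.univ p (Finset.mem_univ e)
  have h2 := Finset.add_sum_erase Finset.univ q (Finset.mem_univ e)
  have h3 := Finset.add_sum_erase Finset.univ (fun x => |p x - q x|) (Finset.mem_univ e)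
  have h4 : ∑ x ∈ Finset.univ.erase e, |p x - q x| ≤
      ∑ x ∈ Finset.univ.erase e, p x + ∑ x ∈ Finset.univ.erase e, q x := by
    rw [← Finset.sum_add_distrib]
    exact Finset.sum_le_sum fun x _ => abs_le.2 ⟨by linarith [hp x, hq x], by
      linarith [hp x, hq x]⟩
  have h5 : |p e - q e| ≤ (1 - p e) + (1 - q e) := by
    have h6 : 0 ≤ ∑ x ∈ Finset.univ.erase e, p x := Finset.sum_nonneg fun x _ => hp x
    have h7 : 0 ≤ ∑ x ∈ Finset.univ.erase e, q x := Finset.sum_nonneg fun x _ => hq x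
    exact abs_le.2 ⟨by linarith, by linarith⟩
  rw [tvDist, ← h3]
  linarith

/-- Markov's inequality for φ. -/
lemma one_sub_atom_le {p φ : X → ℝ} (hp : ∀ x, 0 ≤ p x) (hp1 : ∑ x, p x = 1) (e : X)
    (hφ0 : 0 ≤ φ e) (hφ : ∀ x, x ≠ e → 1 ≤ φ x) : 1 - p e ≤ ∑ x, p x * φ x := by
  classical
  have h1 := Finset.add_sum_erase Finset.univ p (Finset.mem_univ e)
  have h2 := Finset.add_sum_erase Finset.univ (fun x => p x * φ x) (Finset.mem_univ e)
  have h3 : ∑ x ∈ Finset.univ.erase e, p x ≤ ∑ x ∈ Finset.univ.erase e, p x * φ x :=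
    Finset.sum_le_sum fun x hx =>
      le_mul_of_one_le_right (hp x) (hφ x (Finset.ne_of_mem_erase hx))
  have h4 := mul_nonneg (hp e) hφ0
  linarith

end TotalVariation


/-! ### The hardcore chain at low and at high fugacity. -/

section HardcoreDynamics

variable {V : Type*} [Fintype V] [DecidableEq V] {G : SimpleGraph V} {lam : ℝ}

/-- Configurations correspond to their sets of occupied vertices. -/
def occupiedEquiv (V : Type*) [Fintype V] [DecidableEq V] : (V → Bool) ≃ Finset V where
  toFun σ := Finset.univ.filter fun v => σ v = true
  invFun I v := decide (v ∈ I)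
  left_inv σ := by ext v; simp
  right_inv I := by ext v; simp

lemma hardcoreWeight_eq (σ : V → Bool) :
    hardcoreWeight G lam σ = indepWeight G lam (occupiedEquiv V σ) := by
  have e : (occupiedEquiv V σ : Set V) = {v | σ v = true} := by
    ext v
    simp [occupiedEquiv]
  rw [hardcoreWeight, indepWeight]
  by_cases h : G.IsIndepSet {v | σ v = true}
  · rw [if_pos h, if_pos (by rwa [e])]
    rfl
  · rw [if_neg h, if_neg (by rwa [e])]

lemma sum_hardcoreWeight_mul (h : (V → Bool) → ℝ) :
    ∑ σ, hardcoreWeight G lam σ * h σ = ∑ I ∈ (Finset.univ : Finset V).powerset,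
      indepWeight G lam I * h ((occupiedEquiv V).symm I) := by
  rw [Finset.powerset_univ]
  exact Fintype.sum_equiv (occupiedEquiv V) _ _ fun σ => by
    rw [hardcoreWeight_eq, Equiv.symm_apply_apply]

lemma sum_hardcoreWeight :
    ∑ σ, hardcoreWeight G lam σ = partitionFn G lam Finset.univ := by
  have := sum_hardcoreWeight_mul (G := G) (lam := lam) fun _ => 1
  simp only [mul_one] at this
  exact this

lemma hardcoreGibbs_eq (σ : V → Bool) :
    hardcoreGibbs G lam σ =
      indepWeight G lam (occupiedEquiv V σ) / partitionFn G lam Finset.univ := by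
  rw [hardcoreGibbs, hardcoreWeight_eq, sum_hardcoreWeight]

lemma hardcoreGibbs_nonneg (h : 0 ≤ lam) (σ : V → Bool) : 0 ≤ hardcoreGibbs G lam σ := by
  rw [hardcoreGibbs_eq]
  exact div_nonneg (indepWeight_nonneg h _) (partitionFn_pos h _).le

lemma sum_hardcoreGibbs_mul (h : (V → Bool) → ℝ) :
    ∑ σ, hardcoreGibbs G lam σ * h σ =
      (∑ I ∈ (Finset.univ : Finset V).powerset,
        indepWeight G lam I * h ((occupiedEquiv V).symm I)) / partitionFn G lam Finset.univ := by
  rw [← sum_hardcoreWeight_mul, Finset.sum_div]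
  refine Finset.sum_congr rfl fun σ _ => ?_
  rw [hardcoreGibbs, sum_hardcoreWeight]
  ring

lemma sum_hardcoreGibbs (h : 0 ≤ lam) : ∑ σ, hardcoreGibbs G lam σ = 1 := by
  have := sum_hardcoreGibbs_mul (G := G) (lam := lam) fun _ => 1
  simp only [mul_one] at this
  rw [this]
  exact div_self (partitionFn_pos h _).ne'

lemma update_true (I : Finset V) (v : V) :
    Function.update ((occupiedEquiv V).symm I) v true = (occupiedEquiv V).symm (insert v I) := by
  ext w
  by_cases hw : w = v
  · subst hw; simp [occupiedEquiv]
  · simp [occupiedEquiv, hw]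

lemma update_false (I : Finset V) (v : V) :
    Function.update ((occupiedEquiv V).symm I) v false = (occupiedEquiv V).symm (I.erase v) := by
  ext w
  by_cases hw : w = v
  · subst hw; simp [occupiedEquiv]
  · simp [occupiedEquiv, hw]

lemma siteAverage_hardcoreGibbs (h : 0 ≤ lam) (v : V) (f : (V → Bool) → ℝ) (I : Finset V) :
    siteAverage (hardcoreGibbs G lam) v f ((occupiedEquiv V).symm I) =
      (indepWeight G lam (insert v I) * f ((occupiedEquiv V).symm (insert v I)) +
        indepWeight G lam (I.erase v) * f ((occupiedEquiv V).symm (I.erase v))) /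
      (indepWeight G lam (insert v I) + indepWeight G lam (I.erase v)) := by
  have hZ := partitionFn_pos (G := G) h Finset.univ
  simp only [siteAverage, siteConditional, Fintype.sum_bool, update_true, update_false,
    hardcoreGibbs_eq, Equiv.apply_symm_apply]
  rw [← add_div, div_div_div_cancel_right₀ hZ.ne', div_div_div_cancel_right₀ hZ.ne',
    div_mul_eq_mul_div, div_mul_eq_mul_div, add_div]

lemma indepWeight_insert_eq_or {v : V} {I : Finset V} (hv : v ∉ I) :
    indepWeight G lam (insert v I) = lam * indepWeight G lam I ∨
      indepWeight G lam (insert v I) = 0 := by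
  classical
  rw [indepWeight_insert hv]
  split_ifs
  · exact .inl rfl
  · exact .inr rfl

/-- If v is free, it is occupied or vacant with weights λ : 1, and the two-point variance produces
the factor 1/(1 + λ). If v is blocked, both sides vanish. -/
lemma sum_local_variance (h : 0 ≤ lam) (v : V) (f : (V → Bool) → ℝ) :
    ∑ σ, hardcoreGibbs G lam σ *
        (f σ ^ 2 - siteAverage (hardcoreGibbs G lam) v f σ ^ 2) =
      (∑ I ∈ (Finset.univ.erase v).powerset, indepWeight G lam (insert v I) *
        (f ((occupiedEquiv V).symm (insert v I)) - f ((occupiedEquiv V).symm I)) ^ 2) /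
        (partitionFn G lam Finset.univ * (1 + lam)) := by
  rw [sum_hardcoreGibbs_mul (fun σ => f σ ^ 2 - siteAverage (hardcoreGibbs G lam) v f σ ^ 2),
    mul_comm (partitionFn G lam _), ← div_div]
  congr 1
  have hl : (0 : ℝ) < 1 + lam := by linarith
  rw [eq_div_iff hl.ne']
  conv_lhs => rw [← Finset.insert_erase (Finset.mem_univ v),
    Finset.sum_powerset_insert (Finset.notMem_erase v _), ← Finset.sum_add_distrib,
    Finset.sum_mul]
  refine Finset.sum_congr rfl fun I hI => ?_
  have hv : v ∉ I := fun h' => Finset.notMem_erase v _ (Finset.mem_powerset.1 hI h')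
  rw [siteAverage_hardcoreGibbs h, siteAverage_hardcoreGibbs h, Finset.erase_insert hv,
    Finset.insert_idem, Finset.erase_eq_of_notMem hv]
  generalize f ((occupiedEquiv V).symm (insert v I)) = y
  generalize f ((occupiedEquiv V).symm I) = x
  rcases (indepWeight_nonneg (G := G) h I).eq_or_lt with h0 | h0
  · rcases indepWeight_insert_eq_or (G := G) (lam := lam) hv with h1 | h1 <;> simp [h1, ← h0]
  · rcases indepWeight_insert_eq_or (G := G) (lam := lam) hv with h1 | h1
    · rw [h1]
      have : lam * indepWeight G lam I + indepWeight G lam I = (1 + lam) * indepWeight G lam I := by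
        ring
      rw [this]
      field_simp
      ring
    · rw [h1]
      field_simp
      ring

lemma Poincare.glauber [Nonempty V] (h : 0 ≤ lam) {c : ℝ} (hc : 0 < c)
    (hP : Poincare G lam Finset.univ c) :
    PoincareGlauber (hardcoreGibbs G lam) (1 / (Fintype.card V * ((1 + lam) * c))) := by
  intro f
  have hZ := partitionFn_pos (G := G) h Finset.univ
  have hl : (0 : ℝ) < 1 + lam := by linarith
  have hn : (0 : ℝ) < Fintype.card V := by exact_mod_cast Fintype.card_pos
  simp only [sum_local_variance h]
  rw [← Finset.sum_div, sum_hardcoreGibbs_mul (fun σ => f σ ^ 2), sum_hardcoreGibbs_mul]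
  have hp := hP fun I => f ((occupiedEquiv V).symm I)
  rw [varForm] at hp
  change _ ≤ 1 / (Fintype.card V : ℝ) *
    (dirichletForm G lam Finset.univ (fun I => f ((occupiedEquiv V).symm I)) / _)
  generalize dirichletForm G lam Finset.univ (fun I => f ((occupiedEquiv V).symm I)) = D at *
  generalize ∑ I ∈ (Finset.univ : Finset V).powerset,
    indepWeight G lam I * f ((occupiedEquiv V).symm I) ^ 2 = q at *
  generalize ∑ I ∈ (Finset.univ : Finset V).powerset,
    indepWeight G lam I * f ((occupiedEquiv V).symm I) = m at *
  generalize partitionFn G lam Finset.univ = Z at *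
  have e1 : q / Z - (m / Z) ^ 2 = (Z * q - m ^ 2) / Z ^ 2 := by field_simp
  have e2 : 1 / (Fintype.card V : ℝ) * (D / (Z * (1 + lam))) =
      1 / (Fintype.card V * ((1 + lam) * c)) * ((c * Z * D) / Z ^ 2) := by field_simp
  rw [e1, e2]
  gcongr

/-- The number of occupied vertices. -/
noncomputable def occupation (σ : V → Bool) : ℝ := ((occupiedEquiv V σ).card : ℝ)

/-- Resampling erases v and puts it back with probability at most λ/(1 + λ) ≤ λ. -/
lemma siteAverage_occupation_le (h : 0 ≤ lam) (v : V) (I : Finset V) :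
    siteAverage (hardcoreGibbs G lam) v occupation ((occupiedEquiv V).symm I) ≤
      I.card - (if v ∈ I then 1 else 0) + lam := by
  have e0 : insert v (I.erase v) = insert v I := by
    ext w
    by_cases hw : w = v <;> simp [hw]
  rw [siteAverage_hardcoreGibbs h]
  simp only [occupation, Equiv.apply_symm_apply]
  have e1 : ((I.erase v).card : ℝ) = I.card - (if v ∈ I then 1 else 0) := by
    split_ifs with hv
    · rw [← Finset.card_erase_add_one hv]; push_cast; ring
    · rw [Finset.erase_eq_of_notMem hv]; ring
  have e2 : ((insert v I).card : ℝ) = (I.erase v).card + 1 := by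
    rw [← e0, Finset.card_insert_of_notMem (Finset.notMem_erase v I)]
    push_cast; ring
  rw [← e1, e2]
  have hk : (0 : ℝ) ≤ (I.erase v).card := Nat.cast_nonneg _
  generalize ((I.erase v).card : ℝ) = k at *
  have h0 := indepWeight_nonneg (G := G) h (I.erase v)
  have h1 : indepWeight G lam (insert v I) = lam * indepWeight G lam (I.erase v) ∨
      indepWeight G lam (insert v I) = 0 := by
    have := indepWeight_insert_eq_or (G := G) (lam := lam) (Finset.notMem_erase v I)
    rwa [e0] at this
  generalize indepWeight G lam (I.erase v) = a at *
  -- For infeasible configurations the average is 0/0 = 0, so the bound still holds.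
  rcases h0.eq_or_lt with h0 | h0
  · rcases h1 with h1 | h1 <;> simp [h1, ← h0] <;> positivity
  · rcases h1 with h1 | h1
    · rw [h1, div_le_iff₀ (by positivity)]
      nlinarith [mul_nonneg (mul_nonneg h h) h0.le]
    · rw [h1, div_le_iff₀ (by positivity)]
      nlinarith

lemma glauberMatrix_mulVec_occupation_le [Nonempty V] (h : 0 ≤ lam) (σ : V → Bool) :
    (glauberMatrix (hardcoreGibbs G lam)).mulVec occupation σ ≤
      (1 - 1 / (Fintype.card V : ℝ)) * occupation σ
        + (1 - (1 - 1 / (Fintype.card V : ℝ))) * (Fintype.card V * lam) := by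
  have hn : (0 : ℝ) < Fintype.card V := by exact_mod_cast Fintype.card_pos
  obtain ⟨I, rfl⟩ := (occupiedEquiv V).symm.surjective σ
  rw [glauberMatrix_mulVec]
  have h1 := Finset.sum_le_sum fun (v : V) (_ : v ∈ Finset.univ) =>
    siteAverage_occupation_le (G := G) h v I
  have h2 : ∑ v : V, ((I.card : ℝ) - (if v ∈ I then 1 else 0) + lam) =
      Fintype.card V * I.card - I.card + Fintype.card V * lam := by
    rw [Finset.sum_add_distrib, Finset.sum_sub_distrib]
    simp
  rw [h2] at h1
  refine (mul_le_mul_of_nonneg_left h1 (by positivity)).trans (le_of_eq ?_)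
  rw [occupation, Equiv.apply_symm_apply]
  field_simp
  ring

/-- At low fugacity the dynamics quickly empties the graph. -/
lemma tvDist_le_of_small_fugacity [Nonempty V] (h : 0 ≤ lam)
    (hsmall : lam ≤ 1 / (16 * Fintype.card V)) {σ : V → Bool}
    (hσ : 0 < hardcoreGibbs G lam σ) :
    tvDist ((glauberMatrix (hardcoreGibbs G lam) ^ (16 * Fintype.card V ^ 2)) σ)
      (hardcoreGibbs G lam) ≤ 1 / 4 := by
  have hn : (0 : ℝ) < Fintype.card V := by exact_mod_cast Fintype.card_pos
  have hn1 : (1 : ℝ) ≤ Fintype.card V := by exact_mod_cast Fintype.card_pos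
  have hμ := fun τ => hardcoreGibbs_nonneg (G := G) h τ
  have hμ1 := sum_hardcoreGibbs (G := G) h
  set s := 16 * Fintype.card V ^ 2 with hs
  set e : V → Bool := (occupiedEquiv V).symm ∅ with he
  have hφ0 : 0 ≤ occupation e := Nat.cast_nonneg _
  have hφ : ∀ τ, τ ≠ e → 1 ≤ occupation τ := by
    intro τ hτ
    rw [occupation, Nat.one_le_cast, Finset.one_le_card, Finset.nonempty_iff_ne_empty]
    intro h0
    exact hτ (by rw [he, ← h0, Equiv.symm_apply_apply])
  have hr : 0 ≤ 1 - 1 / (Fintype.card V : ℝ) := by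
    rw [sub_nonneg, div_le_one hn]; exact hn1
  have hb : (Fintype.card V : ℝ) * lam ≤ 1 / 16 := by
    rw [le_div_iff₀ (by positivity)] at hsmall
    linarith
  have hstep := fun τ => glauberMatrix_mulVec_occupation_le (G := G) h τ
  have h1 := glauberMatrix_pow_mulVec_le hμ hr hstep (by positivity) hσ s
  have hocc : occupation σ ≤ Fintype.card V := by
    rw [occupation]; exact_mod_cast Finset.card_le_univ _
  -- With s = 16n² the power is at most exp(-16n).
  have hpow : (1 - 1 / (Fintype.card V : ℝ)) ^ s ≤ 1 / (16 * Fintype.card V) := by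
    have h2 : 1 - 1 / (Fintype.card V : ℝ) ≤ Real.exp (-(1 / (Fintype.card V : ℝ))) := by
      linarith [Real.add_one_le_exp (-(1 / (Fintype.card V : ℝ)))]
    refine (pow_le_pow_left₀ hr h2 s).trans ?_
    rw [← Real.exp_nat_mul, hs]
    have h3 : ((16 * Fintype.card V ^ 2 : ℕ) : ℝ) * -(1 / (Fintype.card V : ℝ)) =
        -(16 * Fintype.card V) := by push_cast; field_simp
    rw [h3, Real.exp_neg, ← one_div]
    exact one_div_le_one_div_of_le (by positivity)
      (by linarith [Real.add_one_le_exp (16 * (Fintype.card V : ℝ))])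
  have h2 : (1 - 1 / (Fintype.card V : ℝ)) ^ s * occupation σ ≤ 1 / 16 := by
    calc _ ≤ 1 / (16 * (Fintype.card V : ℝ)) * Fintype.card V :=
          mul_le_mul hpow hocc (Nat.cast_nonneg _) (by positivity)
      _ = 1 / 16 := by field_simp
  -- Averaging the one-step bound over the stationary distribution gives mean occupation at most nλ
  -- ≤ 1/16.
  have h3 : ∑ τ, hardcoreGibbs G lam τ * occupation τ ≤ 1 / 16 := by
    have h4 : ∑ τ, hardcoreGibbs G lam τ *
          (glauberMatrix (hardcoreGibbs G lam)).mulVec occupation τ ≤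
        ∑ τ, hardcoreGibbs G lam τ * ((1 - 1 / (Fintype.card V : ℝ)) * occupation τ
          + (1 - (1 - 1 / (Fintype.card V : ℝ))) * (Fintype.card V * lam)) :=
      Finset.sum_le_sum fun τ _ => mul_le_mul_of_nonneg_left (hstep τ) (hμ τ)
    rw [sum_mul_glauberMatrix_mulVec hμ] at h4
    simp only [mul_add, Finset.sum_add_distrib, ← Finset.sum_mul, hμ1,
      mul_left_comm _ (1 - 1 / (Fintype.card V : ℝ)), ← Finset.mul_sum] at h4
    generalize ∑ τ, hardcoreGibbs G lam τ * occupation τ = m at *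
    have h5 : 1 / (Fintype.card V : ℝ) * m ≤
        1 / (Fintype.card V : ℝ) * (Fintype.card V * lam) := by linarith
    linarith [le_of_mul_le_mul_left h5 (by positivity)]
  have hp := one_sub_atom_le (glauberMatrix_pow_nonneg hμ s σ)
    (glauberMatrix_pow_row_sum hμ hσ s) e hφ0 hφ
  have hq := one_sub_atom_le hμ hμ1 e hφ0 hφ
  have htv := tvDist_le_of_atom (glauberMatrix_pow_nonneg hμ s σ) hμ
    (glauberMatrix_pow_row_sum hμ hσ s) hμ1 e
  have h6 : ∑ τ, (glauberMatrix (hardcoreGibbs G lam) ^ s) σ τ * occupation τ =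
    (glauberMatrix (hardcoreGibbs G lam) ^ s).mulVec occupation σ := rfl
  linarith

lemma partitionFn_univ_le (h : 0 ≤ lam) :
    partitionFn G lam Finset.univ ≤ (1 + lam) ^ Fintype.card V := by
  rw [partitionFn, Finset.powerset_univ, add_comm, ← Fintype.sum_pow_mul_eq_add_pow]
  refine Finset.sum_le_sum fun I _ => ?_
  rw [one_pow, mul_one, indepWeight]
  split_ifs
  · exact le_rfl
  · positivity

/-- The weight is λ^|I| ≥ (1/(16n))^n, and the partition function is at most (1 + λ)^n. -/
lemma hardcoreGibbs_ge [Nonempty V] (hlarge : 1 / (16 * Fintype.card V) ≤ lam) {σ : V → Bool}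
    (hσ : 0 < hardcoreGibbs G lam σ) :
    1 / (16 * Fintype.card V * (1 + lam)) ^ Fintype.card V ≤ hardcoreGibbs G lam σ := by
  have hn : (0 : ℝ) < Fintype.card V := by exact_mod_cast Fintype.card_pos
  have hn1 : (1 : ℝ) ≤ Fintype.card V := by exact_mod_cast Fintype.card_pos
  have h : 0 < lam := lt_of_lt_of_le (by positivity) hlarge
  rw [hardcoreGibbs_eq] at hσ ⊢
  have hw : indepWeight G lam (occupiedEquiv V σ) = lam ^ (occupiedEquiv V σ).card := by
    rw [indepWeight] at hσ ⊢
    split_ifs at hσ ⊢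
    · rfl
    · simp at hσ
  rw [hw, mul_pow, ← div_div, ← one_div_pow]
  refine div_le_div₀ (by positivity) ?_ (partitionFn_pos h.le _) (partitionFn_univ_le h.le)
  refine le_trans (pow_le_pow_of_le_one (by positivity) ?_
    (Finset.card_le_univ (occupiedEquiv V σ))) (pow_le_pow_left₀ (by positivity) hlarge _)
  rw [div_le_one (by positivity)]
  linarith

/-- The constant is 18 = 16 + 2: 1/μ(σ) is at most exp(16n²(1 + λ)), and exp(2n²(1 + λ)) covers the
factor 4 needed for distance 1/4. -/
lemma tvDist_le_of_large_fugacity [Nonempty V] (hlarge : 1 / (16 * Fintype.card V) ≤ lam)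
    {c : ℝ} (hc : 1 ≤ c) (hP : Poincare G lam Finset.univ c) {s : ℕ}
    (hs : 18 * (Fintype.card V : ℝ) ^ 3 * (1 + lam) ^ 2 * c ≤ s) {σ : V → Bool}
    (hσ : 0 < hardcoreGibbs G lam σ) :
    tvDist ((glauberMatrix (hardcoreGibbs G lam) ^ s) σ) (hardcoreGibbs G lam) ≤ 1 / 4 := by
  have hn : (0 : ℝ) < Fintype.card V := by exact_mod_cast Fintype.card_pos
  have hn1 : (1 : ℝ) ≤ Fintype.card V := by exact_mod_cast Fintype.card_pos
  have h : 0 < lam := lt_of_lt_of_le (by positivity) hlarge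
  have hμ := fun τ => hardcoreGibbs_nonneg (G := G) h.le τ
  have hμ1 := sum_hardcoreGibbs (G := G) h.le
  have hge := hardcoreGibbs_ge (G := G) hlarge hσ
  have hden : 1 ≤ (Fintype.card V : ℝ) * ((1 + lam) * c) :=
    one_le_mul_of_one_le_of_one_le hn1 (one_le_mul_of_one_le_of_one_le (by linarith) hc)
  have hγ : 1 / ((Fintype.card V : ℝ) * ((1 + lam) * c)) ≤ 1 := by
    rw [div_le_one (by linarith)]; exact hden
  have htv := (hP.glauber h.le (by linarith)).tvDist_sq_le hμ hμ1 hγ hσ s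
  set γ := 1 / ((Fintype.card V : ℝ) * ((1 + lam) * c)) with hγd
  set n : ℝ := (Fintype.card V : ℝ) with hnd
  have hγs : 18 * n ^ 2 * (1 + lam) ≤ γ * s := by
    rw [hγd, div_mul_eq_mul_div, one_mul, le_div_iff₀ (by linarith)]
    calc 18 * n ^ 2 * (1 + lam) * (n * ((1 + lam) * c)) = 18 * n ^ 3 * (1 + lam) ^ 2 * c := by ring
      _ ≤ (s : ℝ) := hs
  have h1 : (1 - γ) ^ s ≤ Real.exp (-(18 * n ^ 2 * (1 + lam))) := by
    refine (pow_le_pow_left₀ (by linarith)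
      (by linarith [Real.add_one_le_exp (-γ)] : 1 - γ ≤ Real.exp (-γ)) s).trans ?_
    rw [← Real.exp_nat_mul, Real.exp_le_exp]
    linarith
  have h2 : (16 * n * (1 + lam)) ^ Fintype.card V ≤ Real.exp (16 * n ^ 2 * (1 + lam)) := by
    have h3 : 16 * n * (1 + lam) ≤ Real.exp (16 * n * (1 + lam)) := by
      linarith [Real.add_one_le_exp (16 * n * (1 + lam))]
    refine (pow_le_pow_left₀ (by positivity) h3 _).trans (le_of_eq ?_)
    rw [← Real.exp_nat_mul, ← hnd]
    congr 1
    ring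
  have h4 : 4 ≤ Real.exp (2 * n ^ 2 * (1 + lam)) := by
    have h5 : (1 : ℝ) ≤ n ^ 2 * (1 + lam) :=
      one_le_mul_of_one_le_of_one_le (one_le_pow₀ hn1) (by linarith)
    have h6 : (2 : ℝ) ≤ Real.exp 1 := by linarith [Real.add_one_le_exp (1 : ℝ)]
    calc (4 : ℝ) ≤ Real.exp 1 ^ 2 := by nlinarith
      _ = Real.exp 2 := by rw [← Real.exp_nat_mul]; norm_num
      _ ≤ _ := Real.exp_le_exp.2 (by linarith)
  have h7 : 4 * Real.exp (-(18 * n ^ 2 * (1 + lam))) ≤ hardcoreGibbs G lam σ := by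
    refine le_trans ?_ hge
    rw [Real.exp_neg, ← div_eq_mul_inv, div_le_div_iff₀ (Real.exp_pos _) (by positivity), one_mul]
    refine (mul_le_mul h4 h2 (by positivity) (Real.exp_pos _).le).trans (le_of_eq ?_)
    rw [← Real.exp_add]
    congr 1
    ring
  have h8 : (1 - γ) ^ s / (4 * hardcoreGibbs G lam σ) ≤ (1 / 4) ^ 2 := by
    rw [div_le_iff₀ (by linarith)]
    linarith
  exact le_of_sq_le_sq (htv.trans h8) (by norm_num)

end HardcoreDynamics

/-! ### Assembling the mixing time bound. -/

lemma isGlauberMixingTime_exists_le {V Q : Type*} [Fintype V] [DecidableEq V] [Fintype Q]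
    [DecidableEq Q] {μ : (V → Q) → ℝ} {s : ℕ}
    (hs : ∀ σ : V → Q, 0 < μ σ → tvDist ((glauberMatrix μ ^ s) σ) μ ≤ 1 / 4) :
    ∃ T, IsGlauberMixingTime μ T ∧ T ≤ s := by
  classical
  have hex : ∃ s, ∀ σ : V → Q, 0 < μ σ → tvDist ((glauberMatrix μ ^ s) σ) μ ≤ 1 / 4 := ⟨s, hs⟩
  exact ⟨Nat.find hex, ⟨Nat.find_spec hex, fun k hk => Nat.find_min' hex hk⟩,
    Nat.find_min' hex hs⟩

/-- As l = ⌊log₂ n⌋ and t are at least 1, the exponent is at most 2(2l)(2t) + 2lt = 10lt; since log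
2 > 1/2, l ≤ 2 log n, which gives 20. -/
lemma one_add_pow_le_rpow {n t : ℕ} (hn : 2 ≤ n) (ht : 1 ≤ t) {lam : ℝ} (h : 0 < lam) :
    (1 + lam) ^ (2 * ((Nat.log 2 n + 1) * (t + 1)) + 2) ≤
      (n : ℝ) ^ (20 * ((t : ℝ) * Real.log (1 + lam))) := by
  have hn0 : (0 : ℝ) < n := by positivity
  have hL : 0 ≤ Real.log (1 + lam) := Real.log_nonneg (by linarith)
  set l := Nat.log 2 n with hl
  have hl1 : 1 ≤ l := Nat.log_pos (by norm_num) hn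
  have h1 : 2 * ((l + 1) * (t + 1)) + 2 ≤ 10 * (l * t) := by nlinarith
  have h2 : (l : ℝ) ≤ 2 * Real.log n := by
    have h3 : ((2 ^ l : ℕ) : ℝ) ≤ n := by exact_mod_cast Nat.pow_log_le_self 2 (by omega)
    have h4 := Real.log_le_log (by positivity) h3
    push_cast at h4
    rw [Real.log_pow] at h4
    have := Real.log_two_gt_d9
    have hl0 : (0 : ℝ) ≤ l := Nat.cast_nonneg _
    nlinarith
  rw [← Real.rpow_natCast, Real.rpow_def_of_pos (by linarith), Real.rpow_def_of_pos hn0,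
    Real.exp_le_exp]
  have h5 : ((2 * ((l + 1) * (t + 1)) + 2 : ℕ) : ℝ) ≤ 10 * (l * t) := by exact_mod_cast h1
  calc Real.log (1 + lam) * ((2 * ((l + 1) * (t + 1)) + 2 : ℕ) : ℝ)
      ≤ Real.log (1 + lam) * (10 * (l * t)) := mul_le_mul_of_nonneg_left h5 hL
    _ ≤ Real.log (1 + lam) * (10 * (2 * Real.log n * t)) := by gcongr
    _ = _ := by ring

theorem theorem1p1 :
    ∃ C : ℝ, 0 < C ∧
      ∀ (V : Type*) [Fintype V] [DecidableEq V] (G : SimpleGraph V) (t : ℕ) (lam : ℝ),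
        treewidth G = t → 1 ≤ t → 0 < lam →
          ∃ T : ℕ, IsGlauberMixingTime (hardcoreGibbs G lam) T ∧
            (T : ℝ) ≤ (Fintype.card V : ℝ) ^ (C * (1 + (t : ℝ) * Real.log (1 + lam))) := by
  refine ⟨20, by norm_num, fun V _ _ G t lam htw ht hlam => ?_⟩
  have hn2 : 2 ≤ Fintype.card V := two_le_card_of_treewidth ht htw
  have hne : Nonempty V := Fintype.card_pos_iff.1 (by omega)
  have hn2r : (2 : ℝ) ≤ Fintype.card V := by exact_mod_cast hn2
  have hn1 : (1 : ℝ) ≤ Fintype.card V := by linarith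
  have hn0 : (0 : ℝ) < Fintype.card V := by linarith
  have hL : 0 ≤ (t : ℝ) * Real.log (1 + lam) :=
    mul_nonneg (Nat.cast_nonneg _) (Real.log_nonneg (by linarith))
  rcases le_total lam (1 / (16 * Fintype.card V)) with hsmall | hlarge
  · obtain ⟨T, hT, hTs⟩ := isGlauberMixingTime_exists_le
      fun σ hσ => tvDist_le_of_small_fugacity (G := G) hlam.le hsmall hσ
    refine ⟨T, hT, ?_⟩
    calc (T : ℝ) ≤ ((16 * Fintype.card V ^ 2 : ℕ) : ℝ) := by exact_mod_cast hTs
      _ = 2 ^ 4 * (Fintype.card V : ℝ) ^ 2 := by push_cast; norm_num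
      _ ≤ (Fintype.card V : ℝ) ^ 4 * (Fintype.card V : ℝ) ^ 2 := by gcongr
      _ = (Fintype.card V : ℝ) ^ (6 : ℝ) := by
          rw [← pow_add, ← Real.rpow_natCast]; norm_num
      _ ≤ _ := Real.rpow_le_rpow_of_exponent_le hn1 (by linarith)
  · obtain ⟨D, hD⟩ := exists_treeDecomposition_card_bag_le ht htw
    set d := (Nat.log 2 (Fintype.card V) + 1) * (t + 1) with hd
    have hdepth : TreeDepthLE G Finset.univ d :=
      D.treeDepthLE_of_card_bag_le hD _ _ (by
        rw [Finset.card_univ]; exact Nat.lt_pow_succ_log_self (by norm_num) _)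
    have hP := hdepth.poincare hlam.le
    set c := 2 * (1 + 2 * lam) ^ d with hc
    have hc2 : 1 ≤ c := by
      have : (1 : ℝ) ≤ (1 + 2 * lam) ^ d := one_le_pow₀ (by linarith)
      linarith
    obtain ⟨T, hT, hTs⟩ := isGlauberMixingTime_exists_le
      fun σ hσ => tvDist_le_of_large_fugacity (G := G) hlarge hc2 hP (Nat.le_ceil _) hσ
    refine ⟨T, hT, ?_⟩
    have hcle : c ≤ 2 * (1 + lam) ^ (2 * d) := by
      have h1 : 1 + 2 * lam ≤ (1 + lam) ^ 2 := by nlinarith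
      rw [hc, pow_mul (1 + lam) 2 d]
      exact mul_le_mul_of_nonneg_left (pow_le_pow_left₀ (by positivity) h1 d) (by norm_num)
    have hone : (1 : ℝ) ≤ (Fintype.card V : ℝ) ^ 3 * (1 + lam) ^ (2 * d + 2) :=
      one_le_mul_of_one_le_of_one_le (one_le_pow₀ hn1) (one_le_pow₀ (by linarith))
    calc (T : ℝ) ≤ (⌈18 * (Fintype.card V : ℝ) ^ 3 * (1 + lam) ^ 2 * c⌉₊ : ℝ) := by
          exact_mod_cast hTs
      _ ≤ 18 * (Fintype.card V : ℝ) ^ 3 * (1 + lam) ^ 2 * c + 1 :=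
          (Nat.ceil_lt_add_one (by positivity)).le
      _ ≤ 18 * (Fintype.card V : ℝ) ^ 3 * (1 + lam) ^ 2 * (2 * (1 + lam) ^ (2 * d))
            + (Fintype.card V : ℝ) ^ 3 * (1 + lam) ^ (2 * d + 2) := by gcongr
      _ = 37 * (Fintype.card V : ℝ) ^ 3 * (1 + lam) ^ (2 * d + 2) := by ring
      -- Numerical constants are absorbed into powers of n, using n ≥ 2.
      _ ≤ 2 ^ 6 * (Fintype.card V : ℝ) ^ 3 * (1 + lam) ^ (2 * d + 2) := by gcongr; norm_num
      _ ≤ (Fintype.card V : ℝ) ^ 6 * (Fintype.card V : ℝ) ^ 3 *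
            (Fintype.card V : ℝ) ^ (20 * ((t : ℝ) * Real.log (1 + lam))) := by
          gcongr
          exact one_add_pow_le_rpow hn2 ht hlam
      _ = (Fintype.card V : ℝ) ^ (9 + 20 * ((t : ℝ) * Real.log (1 + lam))) := by
          rw [← pow_add, Real.rpow_add hn0, ← Real.rpow_natCast]
          norm_num
      _ ≤ _ := Real.rpow_le_rpow_of_exponent_le hn1 (by linarith)
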